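/- Let $(M,g)$ be a smooth four-dimensional spherically symmetric spacetime of signature $(-,+,+,+)$, i.e. the rotation group acts by isometries with spacelike two-spheres (the shells) as orbits; centres, where the orbit degenerates, are excluded. Let $u^a$ be a smooth rotation-invariant unit timelike vector field and $e^a$ a smooth rotation-invariant unit spacelike vector field orthogonal to $u^a$. Put $h_{ab}=g_{ab}+u_au_b$ and $N_{ab}=h_{ab}-e_ae_b$, let $D_a$ be the covariant derivative totally projected with $h$, and write $\dot f=u^a\nabla_af$ and $\hat f=e^aD_af=e^a\nabla_af$ for scalars $f$. Let $$\mathcal A=e^bu^a\nabla_au_b,\quad \Theta=h^{ab}D_au_b,\quad \Sigma=\sigma_{ab}e^ae^b\ \text{ with }\ \sigma_{ab}=D_{(a}u_{b)}-\tfrac13\Theta h_{ab},\quad \phi=N^{ab}D_ae_b,$$ so that $\nabla_au_b=-\mathcal A\,u_ae_b+\tfrac13\Theta h_{ab}+\Sigma(e_ae_b-\tfrac12N_{ab})$ and $D_ae_b=\tfrac12\phi N_{ab}$. Let $T_{ab}=G_{ab}$ be the effective energy-momentum tensor (Einstein's equations with $8\pi G=c=1$, any cosmological term being contained in $T_{ab}$),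 and let $\mu=T_{ab}u^au^b$, $p=\tfrac13h^{ab}T_{ab}$ and $\Pi=\pi_{ab}e^ae^b$, where $\pi_{ab}$ is the symmetric trace-free part of $T_{ab}$ projected with $h$. Let $K$ be the Gaussian curvature of the shells (${}^2R_{ab}=KN_{ab}$ for the induced metric), $C=1/\sqrt K$ their area radius, $\mathcal M=\tfrac C2(1-\nabla_aC\nabla^aC)$ the Misner–Sharp mass, and $\Psi=\Sigma-\tfrac23\Theta$. Then $K$, $\Psi$ and $\phi$ are smooth, $K>0$, and $$\dot K=\left(\Sigma-\tfrac23\Theta\right)K,\qquad \hat K=-\phi K .$$ Moreover $K$ satisfies the closed hyperbolic equation $$\ddot K-\hat{\hat K}+\mathcal F K=0,\qquad \mathcal F=-\left[\dot\Psi+\Psi^2+\hat\phi-\phi^2\right],$$ and the restoration factor is $$\mathcal F=6K-16\mathcal M K^{3/2}+\Psi^2+\Psi\Theta+\mathcal A\phi+\mu-p-\Pi .$$ -/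

import Mathlib

open scoped ContDiff

namespace SphericalSpacetime

noncomputable section

/-- Coordinate space of dimension `n`. -/
abbrev Coord (n : ℕ) := Fin n → ℝ

/-- A field of `n × n` components over a coordinate patch (a metric or another covariant 2-tensor). -/
abbrev TensorField (n : ℕ) := Coord n → Matrix (Fin n) (Fin n) ℝ

/-- The components `vᵃ` (or `w_a`) of a vector (or covector) field over a coordinate patch. -/
abbrev VecField (n : ℕ) := Coord n → Fin n → ℝ

/-- The partial derivative `∂_a f` at `x`. -/
def pd {n : ℕ} (a : Fin n) (f : Coord n → ℝ) (x : Coord n) : ℝ :=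
  fderiv ℝ f x (Pi.single a 1)

/-! ### Tensor calculus of a metric in coordinates, in any dimension -/

/-- Christoffel symbols `Γᵃ_bc` of the Levi-Civita connection. -/
def christoffel {n : ℕ} (g : TensorField n) (a b c : Fin n) (x : Coord n) : ℝ :=
  (1 / 2) * ∑ d, (g x)⁻¹ a d *
    (pd b (fun y => g y d c) x + pd c (fun y => g y d b) x - pd d (fun y => g y b c) x)

/-- Riemann tensor
`Rᵃ_bcd = ∂_c Γᵃ_db - ∂_d Γᵃ_cb + Γᵃ_ce Γᵉ_db - Γᵃ_de Γᵉ_cb`. -/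
def riemann {n : ℕ} (g : TensorField n) (a b c d : Fin n) (x : Coord n) : ℝ :=
  pd c (christoffel g a d b) x - pd d (christoffel g a c b) x
    + ∑ k, (christoffel g a c k x * christoffel g k d b x
        - christoffel g a d k x * christoffel g k c b x)

/-- Ricci tensor `R_bd = Rᵃ_bad`. -/
def ricci {n : ℕ} (g : TensorField n) (x : Coord n) (b d : Fin n) : ℝ :=
  ∑ a, riemann g a b a d x

/-- Ricci scalar `R = gᵃᵇ R_ab`. -/
def scalarCurvature {n : ℕ} (g : TensorField n) (x : Coord n) : ℝ :=
  ∑ a, ∑ b, (g x)⁻¹ a b * ricci g x a b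

/-- Einstein tensor `G_ab = R_ab - (1/2) R g_ab`. -/
def einstein {n : ℕ} (g : TensorField n) (x : Coord n) (a b : Fin n) : ℝ :=
  ricci g x a b - (1 / 2) * scalarCurvature g x * g x a b

/-- Lowering an index: `v_a = g_ab vᵇ`. -/
def lower {n : ℕ} (g : TensorField n) (v : VecField n) : VecField n :=
  fun x a => ∑ b, g x a b * v x b

/-- Covariant derivative of a covector field: `∇_a w_b = ∂_a w_b - Γᶜ_ab w_c`. -/
def covDeriv {n : ℕ} (g : TensorField n) (w : VecField n) (x : Coord n) (a b : Fin n) : ℝ :=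
  pd a (fun y => w y b) x - ∑ c, christoffel g c a b x * w x c

/-- The scalar product `g_ab vᵃ wᵇ`. -/
def innerProd {n : ℕ} (g : TensorField n) (v w : VecField n) (x : Coord n) : ℝ :=
  ∑ a, ∑ b, g x a b * v x a * w x b

/-- Derivative of a scalar along a vector field, `vᵃ ∇_a f`. For `v = u` this is the dot derivative;
for `v = e` it is the hat derivative `eᵃ D_a f`, because `e` is orthogonal to `u`. -/
def along {n : ℕ} (v : VecField n) (f : Coord n → ℝ) (x : Coord n) : ℝ :=
  ∑ a, v x a * pd a f x

/-- Lie derivative of a covariant 2-tensor,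
`(L_ξ g)_ab = ξᶜ ∂_c g_ab + g_cb ∂_a ξᶜ + g_ac ∂_b ξᶜ`. -/
def lieMetric {n : ℕ} (ξ : VecField n) (g : TensorField n) (x : Coord n) (a b : Fin n) : ℝ :=
  ∑ c, (ξ x c * pd c (fun y => g y a b) x
    + g x c b * pd a (fun y => ξ y c) x + g x a c * pd b (fun y => ξ y c) x)

/-- Lie derivative of a vector field, `(L_ξ v)ᵃ = ξᶜ ∂_c vᵃ - vᶜ ∂_c ξᵃ`. -/
def lieVec {n : ℕ} (ξ v : VecField n) (x : Coord n) (a : Fin n) : ℝ :=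
  ∑ c, (ξ x c * pd c (fun y => v y a) x - v x c * pd c (fun y => ξ y a) x)

/-! ### Spherically symmetric spacetimes

Coordinates are `x = (x⁰, x¹, θ, ϕ)`: the pair `(x⁰, x¹)` labels the spherical shell (the orbit of
the rotation group), and `(θ, ϕ)` are standard polar coordinates on it, the rotation group acting
on each shell in the standard way. -/

/-- A smooth Lorentzian metric of signature `(-,+,+,+)` on `U`. -/
structure IsLorentzMetric (U : Set (Coord 4)) (g : TensorField 4) : Prop where
  smooth : ∀ a b, ContDiffOn ℝ ∞ (fun x => g x a b) U
  symm : ∀ x ∈ U, (g x).IsSymm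
  signature : ∀ x ∈ U, ∃ P : Matrix (Fin 4) (Fin 4) ℝ,
    IsUnit P.det ∧ P.transpose * g x * P = Matrix.diagonal ![-1, 1, 1, 1]

/-- The generators of the rotation group in polar coordinates:
`- sin ϕ ∂_θ - cot θ cos ϕ ∂_ϕ`, `cos ϕ ∂_θ - cot θ sin ϕ ∂_ϕ` and `∂_ϕ`. -/
def rotation (i : Fin 3) : VecField 4 := fun x =>
  ![![0, 0, -Real.sin (x 3), -(Real.cos (x 2) / Real.sin (x 2)) * Real.cos (x 3)],
    ![0, 0, Real.cos (x 3), -(Real.cos (x 2) / Real.sin (x 2)) * Real.sin (x 3)],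
    ![0, 0, 0, 1]] i

/-- The metric is invariant under rotations: the three generators are Killing vector fields. -/
def RotationInvariantMetric (U : Set (Coord 4)) (g : TensorField 4) : Prop :=
  ∀ i, ∀ x ∈ U, ∀ a b, lieMetric (rotation i) g x a b = 0

/-- A vector field is invariant under rotations. -/
def RotationInvariantVec (U : Set (Coord 4)) (v : VecField 4) : Prop :=
  ∀ i, ∀ x ∈ U, ∀ a, lieVec (rotation i) v x a = 0

/-- A spherically symmetric spacetime (on a patch `U` of polar coordinates) with its 1+1+2 frame:
a unit timelike field `u` and a unit spacelike field `e` orthogonal to it, both compatible with the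
symmetry. -/
structure IsSphericallySymmetric (U : Set (Coord 4)) (g : TensorField 4) (u e : VecField 4) :
    Prop where
  isOpen : IsOpen U
  polar : ∀ x ∈ U, 0 < x 2 ∧ x 2 < Real.pi
  lorentz : IsLorentzMetric U g
  invariant_metric : RotationInvariantMetric U g
  smooth_u : ∀ a, ContDiffOn ℝ ∞ (fun x => u x a) U
  smooth_e : ∀ a, ContDiffOn ℝ ∞ (fun x => e x a) U
  invariant_u : RotationInvariantVec U u
  invariant_e : RotationInvariantVec U e
  unit_u : ∀ x ∈ U, innerProd g u u x = -1
  unit_e : ∀ x ∈ U, innerProd g e e x = 1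
  orthogonal : ∀ x ∈ U, innerProd g u e x = 0

/-- Einstein's field equations `G_ab = T_ab` in units with `8πG = c = 1`, `T` being the effective
energy-momentum tensor (it contains any cosmological term). -/
def EinsteinEquations (U : Set (Coord 4)) (g T : TensorField 4) : Prop :=
  ∀ x ∈ U, ∀ a b, einstein g x a b = T x a b

/-! ### The 1+1+2 scalars -/

/-- `h_ab = g_ab + u_a u_b`. -/
def hLow (g : TensorField 4) (u : VecField 4) (x : Coord 4) (a b : Fin 4) : ℝ :=
  g x a b + lower g u x a * lower g u x b

/-- `hᵃᵇ = gᵃᵇ + uᵃ uᵇ`. -/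
def hUp (g : TensorField 4) (u : VecField 4) (x : Coord 4) (a b : Fin 4) : ℝ :=
  (g x)⁻¹ a b + u x a * u x b

/-- `hᵃ_b = δᵃ_b + uᵃ u_b`. -/
def hMix (g : TensorField 4) (u : VecField 4) (x : Coord 4) (a b : Fin 4) : ℝ :=
  (if a = b then 1 else 0) + u x a * lower g u x b

/-- `Nᵃᵇ = gᵃᵇ + uᵃ uᵇ - eᵃ eᵇ`. -/
def sheetUp (g : TensorField 4) (u e : VecField 4) (x : Coord 4) (a b : Fin 4) : ℝ :=
  hUp g u x a b - e x a * e x b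

/-- Fully projected spatial derivative `D_a w_b = hᶜ_a hᵈ_b ∇_c w_d`. -/
def spatialDeriv (g : TensorField 4) (u w : VecField 4) (x : Coord 4) (a b : Fin 4) : ℝ :=
  ∑ c, ∑ d, hMix g u x c a * hMix g u x d b * covDeriv g w x c d

/-- Acceleration scalar `𝒜 = A_b eᵇ` with `A_b = uᵃ ∇_a u_b`. -/
def acceleration (g : TensorField 4) (u e : VecField 4) (x : Coord 4) : ℝ :=
  ∑ b, (∑ a, u x a * covDeriv g (lower g u) x a b) * e x b

/-- Expansion `Θ = hᵃᵇ D_a u_b`. -/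
def expansion (g : TensorField 4) (u : VecField 4) (x : Coord 4) : ℝ :=
  ∑ a, ∑ b, hUp g u x a b * spatialDeriv g u (lower g u) x a b

/-- Shear tensor `σ_ab = D_(a u_b) - (1/3) Θ h_ab`. -/
def shearTensor (g : TensorField 4) (u : VecField 4) (x : Coord 4) (a b : Fin 4) : ℝ :=
  (spatialDeriv g u (lower g u) x a b + spatialDeriv g u (lower g u) x b a) / 2
    - (1 / 3) * expansion g u x * hLow g u x a b

/-- Shear scalar `Σ = σ_ab eᵃ eᵇ`, the coefficient in `σ_ab = Σ (e_a e_b - (1/2) N_ab)`. -/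
def shear (g : TensorField 4) (u e : VecField 4) (x : Coord 4) : ℝ :=
  ∑ a, ∑ b, shearTensor g u x a b * e x a * e x b

/-- Sheet expansion `φ = Nᵃᵇ D_a e_b`, the coefficient in `D_a e_b = (1/2) φ N_ab`. -/
def sheetExpansion (g : TensorField 4) (u e : VecField 4) (x : Coord 4) : ℝ :=
  ∑ a, ∑ b, sheetUp g u e x a b * spatialDeriv g u (lower g e) x a b

/-- Energy density `μ = T_ab uᵃ uᵇ`. -/
def energyDensity (T : TensorField 4) (u : VecField 4) (x : Coord 4) : ℝ :=
  ∑ a, ∑ b, T x a b * u x a * u x b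

/-- Isotropic pressure `p = (1/3) hᵃᵇ T_ab`. -/
def pressure (g T : TensorField 4) (u : VecField 4) (x : Coord 4) : ℝ :=
  (1 / 3) * ∑ a, ∑ b, hUp g u x a b * T x a b

/-- Anisotropic stress `π_ab = hᶜ_(a hᵈ_b) T_cd - p h_ab`. -/
def anisotropicStress (g T : TensorField 4) (u : VecField 4) (x : Coord 4) (a b : Fin 4) : ℝ :=
  (∑ c, ∑ d, hMix g u x c a * hMix g u x d b * ((T x c d + T x d c) / 2))
    - pressure g T u x * hLow g u x a b

/-- Anisotropic pressure scalar `Π = π_ab eᵃ eᵇ`, the coefficient in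
`π_ab = Π (e_a e_b - (1/2) N_ab)`. -/
def anisotropicPressure (g T : TensorField 4) (u e : VecField 4) (x : Coord 4) : ℝ :=
  ∑ a, ∑ b, anisotropicStress g T u x a b * e x a * e x b

/-- `Ψ = Σ - (2/3) Θ`. -/
def Psi (g : TensorField 4) (u e : VecField 4) (x : Coord 4) : ℝ :=
  shear g u e x - (2 / 3) * expansion g u x

/-! ### Gaussian curvature of the shells, Misner–Sharp mass, restoration factor -/

/-- The metric induced on the shell through `x`, in its coordinates `(θ, ϕ)`. -/
def shellMetric (g : TensorField 4) (x : Coord 4) : TensorField 2 := fun y =>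
  (g ![x 0, x 1, y 0, y 1]).submatrix ![2, 3] ![2, 3]

/-- Gaussian curvature at `x` of the shell through `x`: half the Ricci scalar of the induced metric,
that is, the trace of the defining relation `²R_ab = K N_ab`. -/
def gaussCurvature (g : TensorField 4) (x : Coord 4) : ℝ :=
  (1 / 2) * scalarCurvature (shellMetric g x) ![x 2, x 3]

/-- Area radius `C = 1 / √K` of the shells. -/
def areaRadius (g : TensorField 4) (x : Coord 4) : ℝ :=
  1 / Real.sqrt (gaussCurvature g x)

/-- Misner–Sharp mass `(C / 2) (1 - ∇_a C ∇ᵃ C)`. -/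
def misnerSharpMass (g : TensorField 4) (x : Coord 4) : ℝ :=
  areaRadius g x / 2 *
    (1 - ∑ a, ∑ b, (g x)⁻¹ a b * pd a (areaRadius g) x * pd b (areaRadius g) x)

/-- The restoration factor `-[Ψ̇ + Ψ² + φ̂ - φ²]`. -/
def restorationFactor (g : TensorField 4) (u e : VecField 4) (x : Coord 4) : ℝ :=
  -(along u (Psi g u e) x + Psi g u e x ^ 2
    + along e (sheetExpansion g u e) x - sheetExpansion g u e x ^ 2)

end

end SphericalSpacetime

open SphericalSpacetime

/-! Rotation invariance forces a warped product in polar coordinates: with `a = g_θθ`, the metric is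
`γ_AB dxᴬ dxᴮ + a (dθ² + sin² θ dϕ²)`, where `γ` and `a` depend only on the shell, and `u`, `e` have
no angular components (`IsSphericallySymmetric.isPolarForm`). Everything then reduces to the single
function `a`: `K = 1/a`, `Ψ = -u(a)/a` and `φ = e(a)/a` (`gaussCurvature_eq`, `Psi_eq`,
`sheetExpansion_eq`). Smoothness, positivity and the two first-order equations for `K` follow at
once, and the wave equation is the product rule applied to them; none of this uses the field
equations.

The formula for the restoration factor rests on one component of Einstein's equations. The
combination `μ - p - Π` is `G_ab (uᵃuᵇ - eᵃeᵇ)`, which equals the angular trace `Nᵃᵇ R_ab`. For a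
warped product the angular Ricci component is `R_θθ = 1 - ½ □a`, with `□` the wave operator of `γ`
(`ricci_two_two`, `ricci_three_three`). Resolving the gradient of `a` along the frame, and using
that in the two-dimensional quotient `u` has divergence `Θ + Ψ` and `e` has divergence `𝒜`
(`normalDiv_u`, `normalDiv_e`), turns this into an equation for `Ψ̇ + φ̂`. The mass enters because
`|∇C|²` is `(φ² - Ψ²)/(4K)` (`misnerSharpMass_mul`), so it trades `φ²` for `K`, `Ψ²` and `ℳ
K^(3/2)`. -/

namespace SphericalSpacetime

/-! ### Calculus of partial and directional derivatives. -/

section Calculus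

variable {n : ℕ} {U : Set (Coord n)} {x : Coord n} {f h : Coord n → ℝ}

/-- Derivatives are local, so a formula established on the whole open patch may be differentiated.
The derivatives of Christoffel symbols, `K`, `Ψ` and `φ` are all obtained this way. -/
theorem pd_congr (hU : IsOpen U) (hx : x ∈ U) (hfh : ∀ y ∈ U, f y = h y) (a : Fin n) :
    pd a f x = pd a h x := by
  unfold pd
  rw [Filter.EventuallyEq.fderiv_eq (Filter.eventuallyEq_of_mem (hU.mem_nhds hx) hfh)]

theorem pd_const (a : Fin n) (c : ℝ) : pd a (fun _ => c) x = 0 := by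
  simp [pd]

theorem pd_eq_zero (hU : IsOpen U) (hx : x ∈ U) {c : ℝ} (hf : ∀ y ∈ U, f y = c) (a : Fin n) :
    pd a f x = 0 := by
  rw [pd_congr hU hx hf, pd_const]

theorem pd_add (hf : DifferentiableAt ℝ f x) (hh : DifferentiableAt ℝ h x) (a : Fin n) :
    pd a (fun y => f y + h y) x = pd a f x + pd a h x := by
  unfold pd
  rw [fderiv_fun_add hf hh]; rfl

theorem pd_mul (hf : DifferentiableAt ℝ f x) (hh : DifferentiableAt ℝ h x) (a : Fin n) :
    pd a (fun y => f y * h y) x = f x * pd a h x + pd a f x * h x := by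
  unfold pd
  rw [fderiv_fun_mul hf hh]; simp [mul_comm]

theorem pd_const_mul (c : ℝ) (hf : DifferentiableAt ℝ f x) (a : Fin n) :
    pd a (fun y => c * f y) x = c * pd a f x := by
  rw [pd_mul (differentiableAt_const c) hf, pd_const]; ring

theorem pd_neg (a : Fin n) : pd a (fun y => -f y) x = -pd a f x := by
  unfold pd
  rw [fderiv_fun_neg]; rfl

theorem pd_comp {F : ℝ → ℝ} {F' : ℝ} (hF : HasDerivAt F F' (f x)) (hf : DifferentiableAt ℝ f x)
    (a : Fin n) : pd a (fun y => F (f y)) x = F' * pd a f x := by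
  have := (hF.comp_hasFDerivAt x hf.hasFDerivAt).fderiv
  unfold pd
  rw [show (fun y => F (f y)) = F ∘ f from rfl, this]; simp

theorem pd_coord (a i : Fin n) : pd a (fun y => y i) x = if i = a then 1 else 0 := by
  unfold pd
  have : fderiv ℝ (fun y : Coord n => y i) x = ContinuousLinearMap.proj i :=
    (ContinuousLinearMap.proj (R := ℝ) (φ := fun _ : Fin n => ℝ) i).fderiv
  rw [this]
  simp [Pi.single_apply]

theorem pd_comp_coord {F : ℝ → ℝ} {F' : ℝ} (i : Fin n) (hF : HasDerivAt F F' (x i)) (a : Fin n) :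
    pd a (fun y => F (y i)) x = if i = a then F' else 0 := by
  rw [pd_comp (f := fun y => y i) hF (by fun_prop), pd_coord]; simp

theorem differentiableAt_of_contDiffOn (hU : IsOpen U) (hx : x ∈ U) (hf : ContDiffOn ℝ ∞ f U) :
    DifferentiableAt ℝ f x :=
  (hf.contDiffAt (hU.mem_nhds hx)).differentiableAt (by simp)

theorem contDiffOn_pd (hU : IsOpen U) (hf : ContDiffOn ℝ ∞ f U) (a : Fin n) :
    ContDiffOn ℝ ∞ (pd a f) U := by
  have : ContDiffOn ℝ ∞ (fderiv ℝ f) U := hf.fderiv_of_isOpen hU (by simp)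
  exact this.clm_apply contDiffOn_const

theorem contDiffOn_along (hU : IsOpen U) {v : VecField n}
    (hv : ∀ a, ContDiffOn ℝ ∞ (fun x => v x a) U) (hf : ContDiffOn ℝ ∞ f U) :
    ContDiffOn ℝ ∞ (along v f) U :=
  ContDiffOn.sum fun a _ => (hv a).mul (contDiffOn_pd hU hf a)

theorem along_congr (hU : IsOpen U) (hx : x ∈ U) (hfh : ∀ y ∈ U, f y = h y) (v : VecField n) :
    along v f x = along v h x :=
  Finset.sum_congr rfl fun a _ => by rw [pd_congr hU hx hfh]

theorem along_mul (hf : DifferentiableAt ℝ f x) (hh : DifferentiableAt ℝ h x) (v : VecField n) :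
    along v (fun y => f y * h y) x = f x * along v h x + along v f x * h x := by
  simp only [along, pd_mul hf hh, Finset.mul_sum, Finset.sum_mul, ← Finset.sum_add_distrib]
  exact Finset.sum_congr rfl fun a _ => by ring

theorem along_comp {F : ℝ → ℝ} {F' : ℝ} (hF : HasDerivAt F F' (f x)) (hf : DifferentiableAt ℝ f x)
    (v : VecField n) : along v (fun y => F (f y)) x = F' * along v f x := by
  simp only [along, pd_comp hF hf, Finset.mul_sum]
  exact Finset.sum_congr rfl fun a _ => by ring

end Calculus

theorem hasDerivAt_cot {t : ℝ} (ht : Real.sin t ≠ 0) :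
    HasDerivAt (fun t => Real.cos t / Real.sin t) (-(1 / Real.sin t ^ 2)) t := by
  have := (Real.hasDerivAt_cos t).div (Real.hasDerivAt_sin t) ht
  rwa [show -Real.sin t * Real.sin t - Real.cos t * Real.cos t = -1 by
    linear_combination -Real.sin_sq_add_cos_sq t, neg_div] at this

/-! ### Derivatives of the rotation generators -/

section Rotation

variable {x : Coord 4}

theorem pd_rotation_fst (i : Fin 3) (c : Fin 4) : pd c (fun y => rotation i y 0) x = 0 := by
  fin_cases i <;> simp [rotation, pd_const]

theorem pd_rotation_snd (i : Fin 3) (c : Fin 4) : pd c (fun y => rotation i y 1) x = 0 := by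
  fin_cases i <;> simp [rotation, pd_const]

theorem pd_rotation_zero_two (c : Fin 4) :
    pd c (fun y => rotation 0 y 2) x = if 3 = c then -Real.cos (x 3) else 0 := by
  have : (fun y : Coord 4 => rotation 0 y 2) = fun y => (fun t => -Real.sin t) (y 3) := by
    ext y; simp [rotation]
  rw [this, pd_comp_coord 3 (Real.hasDerivAt_sin _).fun_neg]

theorem pd_rotation_one_two (c : Fin 4) :
    pd c (fun y => rotation 1 y 2) x = if 3 = c then -Real.sin (x 3) else 0 := by
  have : (fun y : Coord 4 => rotation 1 y 2) = fun y => Real.cos (y 3) := by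
    ext y; simp [rotation]
  rw [this, pd_comp_coord 3 (Real.hasDerivAt_cos _)]

theorem pd_cot_mul {F : ℝ → ℝ} {F' : ℝ} (hs : Real.sin (x 2) ≠ 0) (hF : HasDerivAt F F' (x 3))
    (c : Fin 4) :
    pd c (fun y => -(Real.cos (y 2) / Real.sin (y 2)) * F (y 3)) x
      = -(Real.cos (x 2) / Real.sin (x 2)) * (if 3 = c then F' else 0)
        + (if 2 = c then 1 / Real.sin (x 2) ^ 2 else 0) * F (x 3) := by
  have h1 : DifferentiableAt ℝ (fun y : Coord 4 => Real.cos (y 2) / Real.sin (y 2)) x :=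
    (hasDerivAt_cot hs).differentiableAt.comp x (f := fun y : Coord 4 => y 2) (by fun_prop)
  have h2 : DifferentiableAt ℝ (fun y : Coord 4 => F (y 3)) x :=
    hF.differentiableAt.comp x (f := fun y : Coord 4 => y 3) (by fun_prop)
  rw [pd_mul h1.fun_neg h2, pd_neg, pd_comp_coord 3 hF, pd_comp_coord 2 (hasDerivAt_cot hs)]
  split_ifs <;> ring

theorem pd_rotation_zero_three (hs : Real.sin (x 2) ≠ 0) (c : Fin 4) :
    pd c (fun y => rotation 0 y 3) x
      = -(Real.cos (x 2) / Real.sin (x 2)) * (if 3 = c then -Real.sin (x 3) else 0)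
        + (if 2 = c then 1 / Real.sin (x 2) ^ 2 else 0) * Real.cos (x 3) :=
  pd_cot_mul hs (Real.hasDerivAt_cos _) c

theorem pd_rotation_one_three (hs : Real.sin (x 2) ≠ 0) (c : Fin 4) :
    pd c (fun y => rotation 1 y 3) x
      = -(Real.cos (x 2) / Real.sin (x 2)) * (if 3 = c then Real.cos (x 3) else 0)
        + (if 2 = c then 1 / Real.sin (x 2) ^ 2 else 0) * Real.sin (x 3) :=
  pd_cot_mul hs (Real.hasDerivAt_sin _) c

theorem pd_rotation_two (a c : Fin 4) : pd c (fun y => rotation 2 y a) x = 0 := by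
  fin_cases a <;> simp [rotation, pd_const]

/-- A vector field invariant under rotations is orthogonal to the shells. -/
theorem lieVec_polar {v : VecField 4} (hs : Real.sin (x 2) ≠ 0)
    (hv : ∀ i a, lieVec (rotation i) v x a = 0) :
    v x 2 = 0 ∧ v x 3 = 0 := by
  have h02 := hv 0 2
  have h12 := hv 1 2
  have h03 := hv 0 3
  have h13 := hv 1 3
  have h22 := hv 2 2
  have h23 := hv 2 3
  simp [lieVec, Fin.sum_univ_four, pd_rotation_two, pd_rotation_zero_two, pd_rotation_one_two,
    pd_rotation_zero_three hs, pd_rotation_one_three hs] at h02 h12 h03 h13 h22 h23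
  simp [rotation] at h02 h12 h03 h13 h22 h23
  -- The third generator kills the `ϕ`-derivatives. In `cos ϕ` times the first generator plus `sin
  -- ϕ` times the second the `∂_θ` parts cancel, so the corresponding combination of Lie derivatives
  -- retains only derivatives of the generators: a linear condition on the components of `v`.
  have h := Real.sin_sq_add_cos_sq (x 3)
  constructor
  · rw [h23] at h03 h13
    have : v x 2 * (Real.sin (x 2) ^ 2)⁻¹ = 0 := by
      linear_combination (-Real.cos (x 3)) * h03 - Real.sin (x 3) * h13
        - v x 2 * (Real.sin (x 2) ^ 2)⁻¹ * h
    simpa [hs] using this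
  · rw [h22] at h02 h12
    linear_combination (Real.cos (x 3)) * h02 + Real.sin (x 3) * h12
        - v x 3 * h

/-- Components of a metric invariant under rotations. -/
theorem lieMetric_polar {g : TensorField 4} (hs : Real.sin (x 2) ≠ 0)
    (hg : ∀ i a b, lieMetric (rotation i) g x a b = 0) (hsymm : (g x).IsSymm) :
    (g x 0 2 = 0 ∧ g x 1 2 = 0 ∧ g x 0 3 = 0 ∧ g x 1 3 = 0 ∧ g x 2 3 = 0 ∧
      g x 3 3 = Real.sin (x 2) ^ 2 * g x 2 2) ∧
    (∀ a b, pd 3 (fun y => g y a b) x = 0) ∧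
    ∀ a b, a ≠ 3 → b ≠ 3 → pd 2 (fun y => g y a b) x = 0 := by
  have h3 : ∀ a b, pd 3 (fun y => g y a b) x = 0 := by
    intro a b
    have := hg 2 a b
    simp [lieMetric, Fin.sum_univ_four, pd_rotation_two] at this
    simpa [rotation] using this
  have h := Real.sin_sq_add_cos_sq (x 3)
  have e20 := hsymm.apply 0 2
  have e21 := hsymm.apply 1 2
  have e30 := hsymm.apply 0 3
  have e31 := hsymm.apply 1 3
  have e32 := hsymm.apply 2 3
  -- This combination of generators has no `θ`-component. As `∂_ϕ g = 0`, it yields purely algebraic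
  -- relations: the isotropy conditions that fix the angular block and kill the mixed components.
  have key : ∀ a b, (lieMetric (rotation 0) g x a b) * Real.cos (x 3)
      + (lieMetric (rotation 1) g x a b) * Real.sin (x 3) = 0 := by
    intro a b; rw [hg, hg]; ring
  -- This combination of generators is pointwise `∂_θ`. The derivatives of its coefficients
  -- contribute only when an index is `ϕ`.
  have key2 : ∀ a b, (lieMetric (rotation 1) g x a b) * Real.cos (x 3)
      - (lieMetric (rotation 0) g x a b) * Real.sin (x 3) = 0 := by
    intro a b; rw [hg, hg]; ring
  simp only [lieMetric, Fin.sum_univ_four, pd_rotation_fst, pd_rotation_snd, pd_rotation_zero_two,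
    pd_rotation_one_two, pd_rotation_zero_three hs, pd_rotation_one_three hs, h3] at key key2
  have k03 := key 3 0
  have k13 := key 3 1
  have k02 := key 2 0
  have k12 := key 2 1
  have k22 := key 2 2
  have k23 := key 2 3
  simp [rotation] at k03 k13 k02 k12 k22 k23
  have hs2 : (Real.sin (x 2) ^ 2)⁻¹ ≠ 0 := by positivity
  have z (t : ℝ) (ht : (Real.sin (x 2) ^ 2)⁻¹ * t = 0) : t = 0 := by
    simpa [hs2] using ht
  have g23 : g x 2 3 = 0 := by
    apply z
    linear_combination (1 / 2) * k22 - (1 / 2) * (Real.sin (x 2) ^ 2)⁻¹ * (g x 2 3 + g x 3 2) * h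
      - (1 / 2) * (Real.sin (x 2) ^ 2)⁻¹ * e32
  refine ⟨⟨?_, ?_, ?_, ?_, g23, ?_⟩, h3, ?_⟩
  · linear_combination -k03 - g x 2 0 * h - e20
  · linear_combination -k13 - g x 2 1 * h - e21
  · apply z
    linear_combination k02 - (Real.sin (x 2) ^ 2)⁻¹ * g x 3 0 * h - (Real.sin (x 2) ^ 2)⁻¹ * e30
  · apply z
    linear_combination k12 - (Real.sin (x 2) ^ 2)⁻¹ * g x 3 1 * h - (Real.sin (x 2) ^ 2)⁻¹ * e31
  · have : (Real.sin (x 2) ^ 2)⁻¹ * g x 3 3 = g x 2 2 := by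
      linear_combination k23 - ((Real.sin (x 2) ^ 2)⁻¹ * g x 3 3 - g x 2 2) * h
    rw [← this]; field_simp
  · intro a b ha hb
    have := key2 a b
    simp [rotation, ha.symm, hb.symm] at this
    split_ifs at this <;> linear_combination this - pd 2 (fun y => g y a b) x * h

end Rotation

/-! ### Reduction to a warped product. -/

/-- The shape, in polar coordinates, of a spherically symmetric metric and of a frame compatible
with the symmetry: `g = γ_AB dxᴬ dxᴮ + a (dθ² + sin² θ dϕ²)`, with `γ_AB` and `a = g_θθ` constant
on the shells, and `u`, `e` orthogonal to the shells. -/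
structure IsPolarForm (U : Set (Coord 4)) (g : TensorField 4) (u e : VecField 4) : Prop where
  isOpen : IsOpen U
  smooth_g : ∀ a b, ContDiffOn ℝ ∞ (fun x => g x a b) U
  smooth_u : ∀ a, ContDiffOn ℝ ∞ (fun x => u x a) U
  smooth_e : ∀ a, ContDiffOn ℝ ∞ (fun x => e x a) U
  symm : ∀ x ∈ U, ∀ a b, g x b a = g x a b
  sin_pos : ∀ x ∈ U, 0 < Real.sin (x 2)
  g02 : ∀ x ∈ U, g x 0 2 = 0
  g12 : ∀ x ∈ U, g x 1 2 = 0
  g03 : ∀ x ∈ U, g x 0 3 = 0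
  g13 : ∀ x ∈ U, g x 1 3 = 0
  g23 : ∀ x ∈ U, g x 2 3 = 0
  g33 : ∀ x ∈ U, g x 3 3 = Real.sin (x 2) ^ 2 * g x 2 2
  pos : ∀ x ∈ U, 0 < g x 2 2
  dg2 : ∀ x ∈ U, ∀ a b, a ≠ 3 → b ≠ 3 → pd 2 (fun y => g y a b) x = 0
  dg3 : ∀ x ∈ U, ∀ a b, pd 3 (fun y => g y a b) x = 0
  u2 : ∀ x ∈ U, u x 2 = 0
  u3 : ∀ x ∈ U, u x 3 = 0
  e2 : ∀ x ∈ U, e x 2 = 0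
  e3 : ∀ x ∈ U, e x 3 = 0
  unit_u : ∀ x ∈ U, g x 0 0 * u x 0 * u x 0 + 2 * (g x 0 1 * u x 0 * u x 1)
    + g x 1 1 * u x 1 * u x 1 = -1
  unit_e : ∀ x ∈ U, g x 0 0 * e x 0 * e x 0 + 2 * (g x 0 1 * e x 0 * e x 1)
    + g x 1 1 * e x 1 * e x 1 = 1
  orthogonal : ∀ x ∈ U, g x 0 0 * u x 0 * e x 0 + g x 0 1 * (u x 0 * e x 1 + u x 1 * e x 0)
    + g x 1 1 * u x 1 * e x 1 = 0

/-- A Lorentzian metric has no two-dimensional subspace on which it is not positive. -/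
theorem pos_of_signature {G P : Matrix (Fin 4) (Fin 4) ℝ} {s : ℝ} (hs : 0 < s)
    (hP : IsUnit P.det) (h : P.transpose * G * P = Matrix.diagonal ![-1, 1, 1, 1])
    (h20 : G 2 0 = 0) (h21 : G 2 1 = 0) (h23 : G 2 3 = 0) (h33 : G 3 3 = s ^ 2 * G 2 2) :
    0 < G 2 2 := by
  have hG : G = P⁻¹.transpose * Matrix.diagonal ![-1, 1, 1, 1] * P⁻¹ := by
    rw [← h, Matrix.transpose_nonsing_inv]
    have hPt : IsUnit P.transpose.det := by rwa [Matrix.det_transpose]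
    simp only [Matrix.mul_assoc, Matrix.mul_nonsing_inv _ hP, Matrix.mul_one,
      Matrix.nonsing_inv_mul_cancel_left _ _ hPt]
  have hdet : G.det ≠ 0 := by
    intro h0
    have := congrArg Matrix.det h
    simp [Matrix.det_mul, h0, Matrix.det_diagonal, Fin.prod_univ_four] at this
  -- If `G 2 2` vanished, the whole third row would, against nondegeneracy.
  have hne : G 2 2 ≠ 0 := by
    intro h0
    refine hdet (Matrix.det_eq_zero_of_row_eq_zero 2 fun j => ?_)
    fin_cases j <;> assumption
  set S := P⁻¹
  have entry (a b : Fin 4) : G a b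
      = -(S 0 a * S 0 b) + S 1 a * S 1 b + S 2 a * S 2 b + S 3 a * S 3 b := by
    rw [hG]
    simp [Matrix.mul_apply, Fin.sum_univ_four, Matrix.diagonal_apply]
  have e22 := entry 2 2
  have e23 := entry 2 3
  have e33 := entry 3 3
  rw [h23] at e23
  rw [h33] at e33
  by_contra hcon
  have hneg : G 2 2 < 0 := lt_of_le_of_ne (not_lt.mp hcon) hne
  -- The form is evaluated on the angular vector `(S 0 3, -S 0 2)`. Its timelike coordinate in the
  -- diagonalising basis is zero, so the value is a sum of squares.
  have key : G 2 2 * (S 0 3 ^ 2 + s ^ 2 * S 0 2 ^ 2)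
      = (S 1 2 * S 0 3 - S 1 3 * S 0 2) ^ 2 + (S 2 2 * S 0 3 - S 2 3 * S 0 2) ^ 2
        + (S 3 2 * S 0 3 - S 3 3 * S 0 2) ^ 2 := by
    linear_combination S 0 3 ^ 2 * e22 + S 0 2 ^ 2 * e33 - 2 * S 0 2 * S 0 3 * e23
  by_cases h0 : S 0 2 = 0
  · rw [h0] at e22
    nlinarith [sq_nonneg (S 1 2), sq_nonneg (S 2 2), sq_nonneg (S 3 2)]
  · have : 0 < S 0 3 ^ 2 + s ^ 2 * S 0 2 ^ 2 := by positivity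
    have h1 := mul_neg_of_neg_of_pos hneg this
    rw [key] at h1
    exact absurd h1 (not_lt.mpr (by positivity))

theorem IsSphericallySymmetric.isPolarForm {U : Set (Coord 4)} {g : TensorField 4}
    {u e : VecField 4} (hS : IsSphericallySymmetric U g u e) : IsPolarForm U g u e := by
  have hs : ∀ x ∈ U, 0 < Real.sin (x 2) := fun x hx =>
    Real.sin_pos_of_pos_of_lt_pi (hS.polar x hx).1 (hS.polar x hx).2
  have hg := fun x hx => lieMetric_polar (hs x hx).ne' (fun i a b => hS.invariant_metric i x hx a b)
    (hS.lorentz.symm x hx)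
  have hu := fun x hx => lieVec_polar (hs x hx).ne' (fun i a => hS.invariant_u i x hx a)
  have he := fun x hx => lieVec_polar (hs x hx).ne' (fun i a => hS.invariant_e i x hx a)
  have hsymm : ∀ x ∈ U, ∀ a b, g x b a = g x a b := fun x hx a b =>
    (hS.lorentz.symm x hx).apply a b
  exact
  { isOpen := hS.isOpen
    smooth_g := hS.lorentz.smooth
    smooth_u := hS.smooth_u
    smooth_e := hS.smooth_e
    symm := hsymm
    sin_pos := hs
    g02 := fun x hx => (hg x hx).1.1
    g12 := fun x hx => (hg x hx).1.2.1
    g03 := fun x hx => (hg x hx).1.2.2.1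
    g13 := fun x hx => (hg x hx).1.2.2.2.1
    g23 := fun x hx => (hg x hx).1.2.2.2.2.1
    g33 := fun x hx => (hg x hx).1.2.2.2.2.2
    pos := fun x hx => by
      obtain ⟨⟨h02, h12, h03, h13, h23, h33⟩, -⟩ := hg x hx
      obtain ⟨P, hP, h⟩ := hS.lorentz.signature x hx
      exact pos_of_signature (hs x hx) hP h (by rw [hsymm x hx, h02]) (by rw [hsymm x hx, h12])
        h23 h33
    dg2 := fun x hx => (hg x hx).2.2
    dg3 := fun x hx => (hg x hx).2.1
    u2 := fun x hx => (hu x hx).1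
    u3 := fun x hx => (hu x hx).2
    e2 := fun x hx => (he x hx).1
    e3 := fun x hx => (he x hx).2
    unit_u := fun x hx => by
      have h := hS.unit_u x hx
      simp only [innerProd, Fin.sum_univ_four, (hu x hx).1, (hu x hx).2] at h
      linear_combination h - u x 0 * u x 1 * hsymm x hx 0 1
    unit_e := fun x hx => by
      have h := hS.unit_e x hx
      simp only [innerProd, Fin.sum_univ_four, (he x hx).1, (he x hx).2] at h
      linear_combination h - e x 0 * e x 1 * hsymm x hx 0 1
    orthogonal := fun x hx => by
      have h := hS.orthogonal x hx
      simp only [innerProd, Fin.sum_univ_four, (he x hx).1, (he x hx).2, (hu x hx).1,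
        (hu x hx).2] at h
      linear_combination h - u x 1 * e x 0 * hsymm x hx 0 1 }

/-! ### Curvature of a round sphere -/

section Sphere

variable {V : Set (Coord 2)} {m : TensorField 2} {b : Coord 2 → ℝ}

theorem inv_diagonal_fin_two {p q : ℝ} (hp : p ≠ 0) (hq : q ≠ 0) :
    (Matrix.diagonal ![p, q])⁻¹ = Matrix.diagonal ![1 / p, 1 / q] := by
  refine Matrix.inv_eq_left_inv ?_
  rw [Matrix.diagonal_mul_diagonal, ← Matrix.diagonal_one]
  congr 1
  ext i
  fin_cases i <;> simp [hp, hq]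

theorem pd_sin_sq_mul {n : ℕ} {f : Coord n → ℝ} {y : Coord n} (i : Fin n)
    (hf : DifferentiableAt ℝ f y) (c : Fin n) :
    pd c (fun z => Real.sin (z i) ^ 2 * f z) y = Real.sin (y i) ^ 2 * pd c f y
      + (if i = c then 2 * Real.sin (y i) * Real.cos (y i) else 0) * f y := by
  have h : HasDerivAt (fun t => Real.sin t ^ 2) (2 * Real.sin (y i) * Real.cos (y i)) (y i) := by
    simpa using (Real.hasDerivAt_sin (y i)).fun_pow 2
  have h1 : DifferentiableAt ℝ (fun z : Coord n => Real.sin (z i) ^ 2) y :=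
    h.differentiableAt.comp y (f := fun z : Coord n => z i) (by fun_prop)
  rw [pd_mul h1 hf, pd_comp_coord i h]

/-- The factor `b` has zero gradient, so it cancels against the inverse metric and the symbols are
those of the unit sphere. -/
theorem christoffel_sphere (hV : IsOpen V) (hs : ∀ y ∈ V, Real.sin (y 0) ≠ 0)
    (hm : ∀ y ∈ V, m y = Matrix.diagonal ![b y, Real.sin (y 0) ^ 2 * b y])
    (hb : ∀ y ∈ V, b y ≠ 0) (hd : ∀ y ∈ V, DifferentiableAt ℝ b y)
    (hb' : ∀ y ∈ V, ∀ i, pd i b y = 0) {y : Coord 2} (hy : y ∈ V) (i j k : Fin 2) :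
    christoffel m i j k y
      = ![![![0, 0], ![0, -(Real.sin (y 0) * Real.cos (y 0))]],
          ![![0, Real.cos (y 0) / Real.sin (y 0)], ![Real.cos (y 0) / Real.sin (y 0), 0]]] i j k := by
  have hs' := hs y hy
  have hb'' := hb y hy
  have hinv : (m y)⁻¹ = Matrix.diagonal ![1 / b y, 1 / (Real.sin (y 0) ^ 2 * b y)] := by
    rw [hm y hy, inv_diagonal_fin_two hb'' (mul_ne_zero (pow_ne_zero 2 hs') hb'')]
  have d00 : ∀ c, pd c (fun z => m z 0 0) y = 0 := fun c => by
    rw [pd_congr hV hy (h := b) (fun z hz => by simp [hm z hz]), hb' y hy]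
  have d01 : ∀ c, pd c (fun z => m z 0 1) y = 0 := fun c =>
    pd_eq_zero hV hy (c := 0) (fun z hz => by simp [hm z hz]) c
  have d10 : ∀ c, pd c (fun z => m z 1 0) y = 0 := fun c =>
    pd_eq_zero hV hy (c := 0) (fun z hz => by simp [hm z hz]) c
  have d11 : ∀ c, pd c (fun z => m z 1 1) y
      = (if 0 = c then 2 * Real.sin (y 0) * Real.cos (y 0) else 0) * b y := fun c => by
    rw [pd_congr hV hy (h := fun z => Real.sin (z 0) ^ 2 * b z) (fun z hz => by simp [hm z hz]),
      pd_sin_sq_mul 0 (hd y hy), hb' y hy]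
    ring
  fin_cases i <;> fin_cases j <;> fin_cases k <;>
    simp [christoffel, hinv, d00, d01, d10, d11] <;> field_simp

theorem scalarCurvature_sphere (hV : IsOpen V) (hs : ∀ y ∈ V, Real.sin (y 0) ≠ 0)
    (hm : ∀ y ∈ V, m y = Matrix.diagonal ![b y, Real.sin (y 0) ^ 2 * b y])
    (hb : ∀ y ∈ V, b y ≠ 0) (hd : ∀ y ∈ V, DifferentiableAt ℝ b y)
    (hb' : ∀ y ∈ V, ∀ i, pd i b y = 0) {y : Coord 2} (hy : y ∈ V) :
    scalarCurvature m y = 2 / b y := by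
  have hΓ := fun z hz => christoffel_sphere hV hs hm hb hd hb' (y := z) hz
  have hs' := hs y hy
  have hb'' := hb y hy
  have hinv : (m y)⁻¹ = Matrix.diagonal ![1 / b y, 1 / (Real.sin (y 0) ^ 2 * b y)] := by
    rw [hm y hy, inv_diagonal_fin_two hb'' (mul_ne_zero (pow_ne_zero 2 hs') hb'')]
  have dz : ∀ i j k, (∀ z : Coord 2, (![![![0, 0], ![0, -(Real.sin (z 0) * Real.cos (z 0))]],
      ![![0, Real.cos (z 0) / Real.sin (z 0)], ![Real.cos (z 0) / Real.sin (z 0), 0]]]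
        : Fin 2 → Fin 2 → Fin 2 → ℝ) i j k = 0) → ∀ c, pd c (christoffel m i j k) y = 0 :=
    fun i j k h c => pd_eq_zero hV hy (fun z hz => by rw [hΓ z hz, h]) c
  have d000 := dz 0 0 0 (fun z => by simp)
  have d001 := dz 0 0 1 (fun z => by simp)
  have d010 := dz 0 1 0 (fun z => by simp)
  have d100 := dz 1 0 0 (fun z => by simp)
  have d111 := dz 1 1 1 (fun z => by simp)
  have d011 : ∀ c, pd c (christoffel m 0 1 1) y
      = if 0 = c then Real.sin (y 0) ^ 2 - Real.cos (y 0) ^ 2 else 0 := fun c => by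
    have h : HasDerivAt (fun t => -(Real.sin t * Real.cos t))
        (Real.sin (y 0) ^ 2 - Real.cos (y 0) ^ 2) (y 0) := by
      rw [show Real.sin (y 0) ^ 2 - Real.cos (y 0) ^ 2
        = -(Real.cos (y 0) * Real.cos (y 0) + Real.sin (y 0) * -Real.sin (y 0)) by ring]
      exact ((Real.hasDerivAt_sin (y 0)).fun_mul (Real.hasDerivAt_cos (y 0))).fun_neg
    rw [pd_congr hV hy (h := fun z => (fun t => -(Real.sin t * Real.cos t)) (z 0))
      (fun z hz => by simp [hΓ z hz]), pd_comp_coord 0 h]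
  have dcot : ∀ i j, i ≠ j → ∀ c, pd c (christoffel m 1 i j) y
      = if 0 = c then -(1 / Real.sin (y 0) ^ 2) else 0 := fun i j hij c => by
    rw [pd_congr hV hy (h := fun z => (fun t => Real.cos t / Real.sin t) (z 0))
      (fun z hz => by fin_cases i <;> fin_cases j <;> simp_all [hΓ z hz]),
      pd_comp_coord 0 (hasDerivAt_cot hs')]
  have d101 := dcot 0 1 (by decide)
  have d110 := dcot 1 0 (by decide)
  simp [scalarCurvature, ricci, riemann, hinv, hΓ y hy, d000, d001, d010, d011, d100, d101, d110,
    d111]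
  have h := Real.sin_sq_add_cos_sq (y 0)
  field_simp
  linear_combination -h

end Sphere

/-! ### Gaussian curvature of the shells. -/

section PolarForm

variable {U : Set (Coord 4)} {g : TensorField 4} {u e : VecField 4} {x : Coord 4}

/-- The partial derivatives of a function restricted to the shell through `x` are its partial
derivatives along `θ` and `ϕ`. -/
theorem pd_shell {f : Coord 4 → ℝ} {y : Coord 2}
    (hf : DifferentiableAt ℝ f ![x 0, x 1, y 0, y 1]) (i : Fin 2) :
    pd i (fun z : Coord 2 => f ![x 0, x 1, z 0, z 1]) y
      = pd (![2, 3] i) f ![x 0, x 1, y 0, y 1] := by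
  have h : HasFDerivAt (fun z : Coord 2 => (![x 0, x 1, z 0, z 1] : Coord 4))
      (ContinuousLinearMap.pi (![0, 0, ContinuousLinearMap.proj (φ := fun _ : Fin 2 => ℝ) 0,
        ContinuousLinearMap.proj (φ := fun _ : Fin 2 => ℝ) 1] : Fin 4 → Coord 2 →L[ℝ] ℝ)) y := by
    rw [hasFDerivAt_pi']
    intro k
    fin_cases k
    · exact hasFDerivAt_const _ _
    · exact hasFDerivAt_const _ _
    · exact hasFDerivAt_apply (𝕜 := ℝ) (0 : Fin 2) y
    · exact hasFDerivAt_apply (𝕜 := ℝ) (1 : Fin 2) y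
  have h2 := (hf.hasFDerivAt.comp y h).fderiv
  unfold pd
  rw [show (fun z : Coord 2 => f ![x 0, x 1, z 0, z 1])
    = f ∘ fun z : Coord 2 => (![x 0, x 1, z 0, z 1] : Coord 4) from rfl, h2,
    ContinuousLinearMap.comp_apply]
  congr 1
  ext k
  fin_cases i <;> fin_cases k <;> simp

namespace IsPolarForm

theorem gaussCurvature_eq (h : IsPolarForm U g u e) (hx : x ∈ U) :
    gaussCurvature g x = 1 / g x 2 2 := by
  -- The part of the shell lying in the patch. It need only be open, since curvature is local.
  set V : Set (Coord 2) := {y | (![x 0, x 1, y 0, y 1] : Coord 4) ∈ U}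
  have hx' : (![x 0, x 1, x 2, x 3] : Coord 4) = x := by
    ext i; fin_cases i <;> rfl
  have hV : IsOpen V := by
    refine h.isOpen.preimage (f := fun y : Coord 2 => (![x 0, x 1, y 0, y 1] : Coord 4)) ?_
    refine continuous_pi fun i => ?_
    fin_cases i <;> simp <;> fun_prop
  have hb : ∀ y ∈ V, DifferentiableAt ℝ (fun z => g z 2 2) ![x 0, x 1, y 0, y 1] := fun y hy =>
    differentiableAt_of_contDiffOn h.isOpen hy (h.smooth_g 2 2)
  have := scalarCurvature_sphere (m := shellMetric g x)
    (b := fun y => g ![x 0, x 1, y 0, y 1] 2 2) (y := ![x 2, x 3]) hV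
    (fun y hy => (h.sin_pos _ hy).ne') (fun y hy => ?_) (fun y hy => (h.pos _ hy).ne')
    (fun y hy => ?_) (fun y hy i => ?_) (by simpa [V, hx'] using hx)
  · rw [gaussCurvature, this]
    simp [hx']
    ring
  · have e1 := h.g23 _ hy
    have e2 := h.g33 _ hy
    have e3 := h.symm _ hy 2 3
    rw [e1] at e3
    ext i j
    fin_cases i <;> fin_cases j <;> simp [shellMetric, e1, e2, e3]
  · refine (hb y hy).comp y (f := fun y : Coord 2 => (![x 0, x 1, y 0, y 1] : Coord 4)) ?_
    rw [differentiableAt_pi]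
    intro i
    fin_cases i <;> simp <;> fun_prop
  · rw [pd_shell (f := fun z => g z 2 2) (hb y hy)]
    fin_cases i
    · exact h.dg2 _ hy 2 2 (by decide) (by decide)
    · exact h.dg3 _ hy 2 2

end IsPolarForm

end PolarForm

/-! ### Covariant derivatives of lowered vector fields. -/

theorem pd_sum {n : ℕ} {ι : Type*} {s : Finset ι} {F : ι → Coord n → ℝ} {x : Coord n}
    (hF : ∀ i ∈ s, DifferentiableAt ℝ (F i) x) (a : Fin n) :
    pd a (fun y => ∑ i ∈ s, F i y) x = ∑ i ∈ s, pd a (F i) x := by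
  unfold pd
  rw [fderiv_fun_sum hF, sum_apply]

/-- The covariant derivative `∇_a v_b` in terms of the components `vᵃ`. -/
theorem covDeriv_lower {n : ℕ} {g : TensorField n} {v : VecField n} {x : Coord n}
    (hg : ∀ a b, DifferentiableAt ℝ (fun y => g y a b) x)
    (hv : ∀ a, DifferentiableAt ℝ (fun y => v y a) x)
    (hdet : IsUnit (g x).det) (hsymm : ∀ a b, g x b a = g x a b)
    (hsymm' : ∀ a b c, pd c (fun y => g y b a) x = pd c (fun y => g y a b) x) (a b : Fin n) :
    covDeriv g (lower g v) x a b = ∑ d, (g x b d * pd a (fun y => v y d) x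
      + 1 / 2 * v x d * (pd a (fun y => g y b d) x + pd d (fun y => g y a b) x
        - pd b (fun y => g y a d) x)) := by
  set X : Fin n → ℝ := fun d => pd a (fun y => g y d b) x + pd b (fun y => g y d a) x
    - pd d (fun y => g y a b) x
  have h1 : ∑ c, christoffel g c a b x * lower g v x c = ∑ d, 1 / 2 * v x d * X d := by
    have h2 : ∀ c, christoffel g c a b x = 1 / 2 * ((g x)⁻¹.mulVec X) c := fun c => rfl
    have h3 : ∀ c, lower g v x c = ((g x).mulVec (v x)) c := fun c => rfl
    have h4 : (g x).transpose = g x := by ext i j; exact hsymm i j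
    -- The inverse metric in the Christoffel symbol cancels against the metric lowering `v`, so the
    -- final formula contains no inverse.
    have h5 : dotProduct ((g x)⁻¹.mulVec X) ((g x).mulVec (v x)) = dotProduct (v x) X := by
      rw [dotProduct_comm, ← Matrix.vecMul_transpose, h4, ← Matrix.dotProduct_mulVec,
        Matrix.mulVec_mulVec, Matrix.mul_nonsing_inv _ hdet, Matrix.one_mulVec]
    calc _ = 1 / 2 * dotProduct ((g x)⁻¹.mulVec X) ((g x).mulVec (v x)) := by
          simp only [h2, h3, dotProduct, Finset.mul_sum, mul_assoc]
      _ = _ := by rw [h5]; simp only [dotProduct, Finset.mul_sum, mul_assoc]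
  have h6 : pd a (fun y => lower g v y b) x
      = ∑ d, (g x b d * pd a (fun y => v y d) x + pd a (fun y => g y b d) x * v x d) := by
    unfold lower
    rw [pd_sum fun d _ => (hg b d).fun_mul (hv d)]
    exact Finset.sum_congr rfl fun d _ => pd_mul (hg b d) (hv d) a
  rw [covDeriv, h1, h6, ← Finset.sum_sub_distrib]
  refine Finset.sum_congr rfl fun d _ => ?_
  simp only [X, hsymm' b d, hsymm' a d]
  ring

/-! ### Frame, inverse metric and the kinematical scalars. -/

namespace IsPolarForm

variable {U : Set (Coord 4)} {g : TensorField 4} {u e : VecField 4} {x : Coord 4}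

theorem differentiableAt_g (h : IsPolarForm U g u e) (hx : x ∈ U) (a b : Fin 4) :
    DifferentiableAt ℝ (fun y => g y a b) x :=
  differentiableAt_of_contDiffOn h.isOpen hx (h.smooth_g a b)

theorem g20 (h : IsPolarForm U g u e) (x) (hx : x ∈ U) : g x 2 0 = 0 := by
  rw [h.symm x hx, h.g02 x hx]

theorem g21 (h : IsPolarForm U g u e) (x) (hx : x ∈ U) : g x 2 1 = 0 := by
  rw [h.symm x hx, h.g12 x hx]

theorem g30 (h : IsPolarForm U g u e) (x) (hx : x ∈ U) : g x 3 0 = 0 := by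
  rw [h.symm x hx, h.g03 x hx]

theorem g31 (h : IsPolarForm U g u e) (x) (hx : x ∈ U) : g x 3 1 = 0 := by
  rw [h.symm x hx, h.g13 x hx]

theorem g32 (h : IsPolarForm U g u e) (x) (hx : x ∈ U) : g x 3 2 = 0 := by
  rw [h.symm x hx, h.g23 x hx]

theorem pd_symm (h : IsPolarForm U g u e) (hx : x ∈ U) (a b c : Fin 4) :
    pd c (fun y => g y b a) x = pd c (fun y => g y a b) x :=
  pd_congr h.isOpen hx (fun y hy => h.symm y hy a b) c

theorem pd_g33 (h : IsPolarForm U g u e) (hx : x ∈ U) (c : Fin 4) :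
    pd c (fun y => g y 3 3) x = Real.sin (x 2) ^ 2 * pd c (fun y => g y 2 2) x
      + (if 2 = c then 2 * Real.sin (x 2) * Real.cos (x 2) else 0) * g x 2 2 := by
  rw [pd_congr h.isOpen hx h.g33, pd_sin_sq_mul 2 (h.differentiableAt_g hx 2 2)]

/-- The frame `u`, `e`, `∂_θ`, `∂_ϕ` as the columns of a matrix. -/
theorem frame_mul (h : IsPolarForm U g u e) (hx : x ∈ U) :
    (Matrix.of ![u x, e x, ![0, 0, 1, 0], ![0, 0, 0, 1]]) * g x
      * (Matrix.of ![u x, e x, ![0, 0, 1, 0], ![0, 0, 0, 1]]).transpose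
      = Matrix.diagonal ![-1, 1, g x 2 2, Real.sin (x 2) ^ 2 * g x 2 2] := by
  have h1 := h.unit_u x hx
  have h2 := h.unit_e x hx
  have h3 := h.orthogonal x hx
  have h10 := h.symm x hx 0 1
  ext i j
  fin_cases i <;> fin_cases j <;>
    simp [Matrix.mul_apply, Matrix.vecMul, dotProduct, Fin.sum_univ_four, h.u2 x hx, h.u3 x hx,
      h.e2 x hx, h.e3 x hx,
      h.g02 x hx, h.g03 x hx, h.g12 x hx, h.g13 x hx, h.g20 x hx, h.g21 x hx, h.g23 x hx,
      h.g30 x hx, h.g31 x hx, h.g32 x hx, h.g33 x hx, h10]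
  · linear_combination h1
  · linear_combination h3
  · linear_combination h3
  · linear_combination h2

/-- With `F` the matrix of frame vectors, `F g Fᵀ = D` is diagonal, hence `g⁻¹ = Fᵀ D⁻¹ F`. The
components of `γ` are thereby never inverted explicitly. -/
theorem inv_apply (h : IsPolarForm U g u e) (hx : x ∈ U) (a b : Fin 4) :
    (g x)⁻¹ a b = -(u x a * u x b) + e x a * e x b
      + Matrix.diagonal ![0, 0, 1 / g x 2 2, 1 / (Real.sin (x 2) ^ 2 * g x 2 2)] a b := by
  have hp := (h.pos x hx).ne'
  have hs := (h.sin_pos x hx).ne'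
  set F : Matrix (Fin 4) (Fin 4) ℝ := Matrix.of ![u x, e x, ![0, 0, 1, 0], ![0, 0, 0, 1]]
  set D' : Matrix (Fin 4) (Fin 4) ℝ :=
    Matrix.diagonal ![-1, 1, 1 / g x 2 2, 1 / (Real.sin (x 2) ^ 2 * g x 2 2)]
  have h1 : F * (g x * F.transpose * D') = 1 := by
    rw [← Matrix.mul_assoc, ← Matrix.mul_assoc, h.frame_mul hx, Matrix.diagonal_mul_diagonal,
      ← Matrix.diagonal_one]
    congr 1
    ext i
    fin_cases i <;> simp <;> field_simp
  have h2 : (g x)⁻¹ = F.transpose * D' * F := by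
    refine Matrix.inv_eq_right_inv ?_
    rw [← Matrix.mul_assoc, ← Matrix.mul_assoc]
    exact mul_eq_one_comm.mp h1
  rw [h2]
  simp [Matrix.mul_apply, Fin.sum_univ_four, F, D', Matrix.diagonal_apply]
  fin_cases a <;> fin_cases b <;> simp

theorem isUnit_det (h : IsPolarForm U g u e) (hx : x ∈ U) : IsUnit (g x).det := by
  have hp := (h.pos x hx).ne'
  have hs := (h.sin_pos x hx).ne'
  rw [isUnit_iff_ne_zero]
  intro h0
  have := congrArg Matrix.det (h.frame_mul hx)
  rw [Matrix.det_mul, Matrix.det_mul, h0, Matrix.det_diagonal] at this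
  simp [Fin.prod_univ_four, hp, hs] at this

theorem covDeriv_lower (h : IsPolarForm U g u e) (hx : x ∈ U) {v : VecField 4}
    (hv : ∀ a, ContDiffOn ℝ ∞ (fun x => v x a) U) (a b : Fin 4) :
    covDeriv g (lower g v) x a b = ∑ d, (g x b d * pd a (fun y => v y d) x
      + 1 / 2 * v x d * (pd a (fun y => g y b d) x + pd d (fun y => g y a b) x
        - pd b (fun y => g y a d) x)) :=
  SphericalSpacetime.covDeriv_lower (h.differentiableAt_g hx)
    (fun a => differentiableAt_of_contDiffOn h.isOpen hx (hv a)) (h.isUnit_det hx) (h.symm x hx)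
    (h.pd_symm hx) a b

/-- Moving along `v` rescales the shell, and the angular part of `∇v` is half the rate of change of
its metric. -/
theorem covDeriv_lower_two_two (h : IsPolarForm U g u e) (hx : x ∈ U) {v : VecField 4}
    (hv : ∀ a, ContDiffOn ℝ ∞ (fun x => v x a) U) (h2 : ∀ y ∈ U, v y 2 = 0) :
    covDeriv g (lower g v) x 2 2 = 1 / 2 * along v (fun y => g y 2 2) x := by
  rw [h.covDeriv_lower hx hv]
  simp only [along, Fin.sum_univ_four, h.g20 x hx, h.g21 x hx, h.g23 x hx,
    pd_eq_zero h.isOpen hx h2]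
  ring

theorem covDeriv_lower_three_three (h : IsPolarForm U g u e) (hx : x ∈ U) {v : VecField 4}
    (hv : ∀ a, ContDiffOn ℝ ∞ (fun x => v x a) U) (h2 : ∀ y ∈ U, v y 2 = 0)
    (h3 : ∀ y ∈ U, v y 3 = 0) :
    covDeriv g (lower g v) x 3 3
      = Real.sin (x 2) ^ 2 * (1 / 2 * along v (fun y => g y 2 2) x) := by
  rw [h.covDeriv_lower hx hv]
  simp [along, Fin.sum_univ_four, h.g30 x hx, h.g31 x hx, h.g32 x hx, h.pd_g33 hx,
    pd_eq_zero h.isOpen hx h3, h2 x hx]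
  ring

theorem lower_two (h : IsPolarForm U g u e) (hx : x ∈ U) {v : VecField 4} (h2 : v x 2 = 0) :
    lower g v x 2 = 0 := by
  simp [lower, Fin.sum_univ_four, h.g20 x hx, h.g21 x hx, h.g23 x hx, h2]

theorem lower_three (h : IsPolarForm U g u e) (hx : x ∈ U) {v : VecField 4} (h3 : v x 3 = 0) :
    lower g v x 3 = 0 := by
  simp [lower, Fin.sum_univ_four, h.g30 x hx, h.g31 x hx, h.g32 x hx, h3]

theorem hMix_two (h : IsPolarForm U g u e) (hx : x ∈ U) (c : Fin 4) :
    hMix g u x c 2 = if c = 2 then 1 else 0 := by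
  simp [hMix, h.lower_two hx (h.u2 x hx)]

theorem hMix_three (h : IsPolarForm U g u e) (hx : x ∈ U) (c : Fin 4) :
    hMix g u x c 3 = if c = 3 then 1 else 0 := by
  simp [hMix, h.lower_three hx (h.u3 x hx)]

theorem sum_lower_u_mul_e (h : IsPolarForm U g u e) (hx : x ∈ U) :
    ∑ a, lower g u x a * e x a = 0 := by
  have h1 := h.orthogonal x hx
  have h10 := h.symm x hx 0 1
  simp only [lower, Fin.sum_univ_four, h.u2 x hx, h.u3 x hx, h.e2 x hx, h.e3 x hx]
  linear_combination h1 + u x 0 * e x 1 * h10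

theorem sum_hMix_mul_e (h : IsPolarForm U g u e) (hx : x ∈ U) (c : Fin 4) :
    ∑ a, hMix g u x c a * e x a = e x c := by
  simp [hMix, add_mul, Finset.sum_add_distrib, mul_assoc, ← Finset.mul_sum,
    h.sum_lower_u_mul_e hx]

theorem sum_hLow_mul_e (h : IsPolarForm U g u e) (hx : x ∈ U) :
    ∑ a, ∑ b, hLow g u x a b * e x a * e x b = 1 := by
  have h1 := h.unit_e x hx
  have h10 := h.symm x hx 0 1
  have h2 := h.sum_lower_u_mul_e hx
  simp only [Fin.sum_univ_four, h.e2 x hx, h.e3 x hx] at h2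
  simp only [hLow, Fin.sum_univ_four, h.e2 x hx, h.e3 x hx]
  linear_combination h1 + e x 0 * e x 1 * h10
    + (lower g u x 0 * e x 0 + lower g u x 1 * e x 1) * h2

/-- Projecting with `h` does not change the `e e` component. -/
theorem sum_projected_mul_e (h : IsPolarForm U g u e) (hx : x ∈ U) (S : Fin 4 → Fin 4 → ℝ) :
    ∑ a, ∑ b, (∑ c, ∑ d, hMix g u x c a * hMix g u x d b * S c d) * e x a * e x b
      = ∑ c, ∑ d, S c d * e x c * e x d := by
  have (c d : Fin 4) : S c d * e x c * e x d
      = ∑ a, ∑ b, hMix g u x c a * hMix g u x d b * S c d * e x a * e x b := by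
    rw [← h.sum_hMix_mul_e hx c, ← h.sum_hMix_mul_e hx d, mul_assoc, Finset.sum_mul_sum,
      Finset.mul_sum]
    refine Finset.sum_congr rfl fun a _ => ?_
    rw [Finset.mul_sum]
    exact Finset.sum_congr rfl fun b _ => by ring
  simp only [this, Fin.sum_univ_four]
  ring

theorem spatialDeriv_two_two (h : IsPolarForm U g u e) (hx : x ∈ U) (w : VecField 4) :
    spatialDeriv g u w x 2 2 = covDeriv g w x 2 2 := by
  simp [spatialDeriv, h.hMix_two hx]

theorem spatialDeriv_three_three (h : IsPolarForm U g u e) (hx : x ∈ U) (w : VecField 4) :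
    spatialDeriv g u w x 3 3 = covDeriv g w x 3 3 := by
  simp [spatialDeriv, h.hMix_three hx]

theorem hUp_apply (h : IsPolarForm U g u e) (hx : x ∈ U) (a b : Fin 4) :
    hUp g u x a b = e x a * e x b
      + Matrix.diagonal ![0, 0, 1 / g x 2 2, 1 / (Real.sin (x 2) ^ 2 * g x 2 2)] a b := by
  rw [hUp, h.inv_apply hx]; ring

theorem sum_hUp_mul (h : IsPolarForm U g u e) (hx : x ∈ U) (S : Fin 4 → Fin 4 → ℝ) :
    ∑ a, ∑ b, hUp g u x a b * S a b = (∑ a, ∑ b, S a b * e x a * e x b)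
      + (S 2 2 + S 3 3 / Real.sin (x 2) ^ 2) / g x 2 2 := by
  have hp := (h.pos x hx).ne'
  have hs := (h.sin_pos x hx).ne'
  simp [h.hUp_apply hx, Matrix.diagonal_apply, Fin.sum_univ_four]
  field_simp
  ring

/-- The longitudinal expansion `eᵃ eᵇ ∇_a u_b`. -/
noncomputable def longitudinalExpansion (g : TensorField 4) (u e : VecField 4) (x : Coord 4) : ℝ :=
  ∑ a, ∑ b, covDeriv g (lower g u) x a b * e x a * e x b

theorem expansion_eq (h : IsPolarForm U g u e) (hx : x ∈ U) :
    expansion g u x = longitudinalExpansion g u e x + along u (fun y => g y 2 2) x / g x 2 2 := by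
  have hp := (h.pos x hx).ne'
  have hs := (h.sin_pos x hx).ne'
  rw [expansion, h.sum_hUp_mul hx, h.spatialDeriv_two_two hx, h.spatialDeriv_three_three hx,
    h.covDeriv_lower_two_two hx h.smooth_u h.u2,
    h.covDeriv_lower_three_three hx h.smooth_u h.u2 h.u3]
  unfold spatialDeriv
  rw [h.sum_projected_mul_e hx]
  unfold longitudinalExpansion
  field_simp
  ring

theorem shear_eq (h : IsPolarForm U g u e) (hx : x ∈ U) :
    shear g u e x = longitudinalExpansion g u e x - 1 / 3 * expansion g u x := by
  have h1 := h.sum_hLow_mul_e hx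
  have h2 := h.sum_projected_mul_e hx (covDeriv g (lower g u) x)
  change ∑ a, ∑ b, spatialDeriv g u (lower g u) x a b * e x a * e x b
    = longitudinalExpansion g u e x at h2
  simp only [Fin.sum_univ_four] at h1 h2
  simp only [shear, shearTensor, Fin.sum_univ_four]
  linear_combination h2 - 1 / 3 * expansion g u x * h1

/-- `Σ - ⅔Θ` is the longitudinal expansion minus `Θ`, so the longitudinal part drops out and only
the growth of the shells remains. -/
theorem Psi_eq (h : IsPolarForm U g u e) (hx : x ∈ U) :
    Psi g u e x = -(along u (fun y => g y 2 2) x / g x 2 2) := by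
  rw [Psi, h.shear_eq hx, h.expansion_eq hx]; ring

theorem sheetExpansion_eq (h : IsPolarForm U g u e) (hx : x ∈ U) :
    sheetExpansion g u e x = along e (fun y => g y 2 2) x / g x 2 2 := by
  have hp := (h.pos x hx).ne'
  have hs := (h.sin_pos x hx).ne'
  simp [sheetExpansion, sheetUp, h.hUp_apply hx, Matrix.diagonal_apply, Fin.sum_univ_four]
  rw [h.spatialDeriv_two_two hx, h.spatialDeriv_three_three hx,
    h.covDeriv_lower_two_two hx h.smooth_e h.e2,
    h.covDeriv_lower_three_three hx h.smooth_e h.e2 h.e3]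
  field_simp
  ring

/-! ### The Ricci tensor of the shells -/

/-- The gradient `∇ᵃ a` of `a = g_θθ`, resolved along the frame. -/
noncomputable def radialGrad (g : TensorField 4) (u e : VecField 4) (c : Fin 4) (x : Coord 4) : ℝ :=
  -(u x c * along u (fun y => g y 2 2) x) + e x c * along e (fun y => g y 2 2) x

theorem pd_offdiag (h : IsPolarForm U g u e) (hx : x ∈ U) (c : Fin 4) :
    (pd c (fun y => g y 0 2) x = 0 ∧ pd c (fun y => g y 1 2) x = 0 ∧
      pd c (fun y => g y 0 3) x = 0 ∧ pd c (fun y => g y 1 3) x = 0 ∧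
      pd c (fun y => g y 2 3) x = 0) ∧
    (pd c (fun y => g y 2 0) x = 0 ∧ pd c (fun y => g y 2 1) x = 0 ∧
      pd c (fun y => g y 3 0) x = 0 ∧ pd c (fun y => g y 3 1) x = 0 ∧
      pd c (fun y => g y 3 2) x = 0) :=
  ⟨⟨pd_eq_zero h.isOpen hx h.g02 c, pd_eq_zero h.isOpen hx h.g12 c,
    pd_eq_zero h.isOpen hx h.g03 c, pd_eq_zero h.isOpen hx h.g13 c,
    pd_eq_zero h.isOpen hx h.g23 c⟩,
   ⟨pd_eq_zero h.isOpen hx h.g20 c, pd_eq_zero h.isOpen hx h.g21 c,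
    pd_eq_zero h.isOpen hx h.g30 c, pd_eq_zero h.isOpen hx h.g31 c,
    pd_eq_zero h.isOpen hx h.g32 c⟩⟩

theorem christoffel_comm (h : IsPolarForm U g u e) (hx : x ∈ U) (a b c : Fin 4) :
    christoffel g a b c x = christoffel g a c b x := by
  unfold christoffel
  congr 1
  refine Finset.sum_congr rfl fun d _ => ?_
  rw [h.pd_symm hx b c d]
  ring

/-- Only `-½ ∇ᶜ g_θθ` survives; this is how the gradient of `a` enters the Ricci tensor. -/
theorem christoffel_two_two (h : IsPolarForm U g u e) (hx : x ∈ U) (c : Fin 4) :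
    christoffel g c 2 2 x = -(1 / 2) * radialGrad g u e c x := by
  simp only [christoffel, Fin.sum_univ_four, h.inv_apply hx, h.pd_offdiag hx, radialGrad, along,
    h.u2 x hx, h.u3 x hx, h.e2 x hx, h.e3 x hx, h.dg3 x hx, h.dg2 x hx 2 2 (by decide) (by decide)]
  fin_cases c <;> simp [h.u2 x hx, h.u3 x hx, h.e2 x hx, h.e3 x hx] <;> ring

theorem christoffel_three_three (h : IsPolarForm U g u e) (hx : x ∈ U) (c : Fin 4) :
    christoffel g c 3 3 x = Real.sin (x 2) ^ 2 * (-(1 / 2) * radialGrad g u e c x)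
      + (if c = 2 then -(Real.sin (x 2) * Real.cos (x 2)) else 0) := by
  have hp := (h.pos x hx).ne'
  simp only [christoffel, Fin.sum_univ_four, h.inv_apply hx, radialGrad, along,
    h.u2 x hx, h.u3 x hx, h.e2 x hx, h.e3 x hx, h.dg3 x hx, h.pd_g33 hx,
    h.dg2 x hx 2 2 (by decide) (by decide)]
  fin_cases c <;> simp [h.u2 x hx, h.u3 x hx, h.e2 x hx, h.e3 x hx] <;> field_simp <;> ring

theorem christoffel_two_three (h : IsPolarForm U g u e) (hx : x ∈ U) (c : Fin 4) :
    christoffel g c 2 3 x = if c = 3 then Real.cos (x 2) / Real.sin (x 2) else 0 := by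
  have hp := (h.pos x hx).ne'
  have hs := (h.sin_pos x hx).ne'
  simp only [christoffel, Fin.sum_univ_four, h.inv_apply hx, h.pd_offdiag hx, h.dg3 x hx,
    h.pd_g33 hx, h.dg2 x hx 2 2 (by decide) (by decide)]
  fin_cases c <;> simp [h.u2 x hx, h.u3 x hx, h.e2 x hx, h.e3 x hx]
  field_simp

theorem christoffel_two (h : IsPolarForm U g u e) (hx : x ∈ U) {b : Fin 4} (hb : b = 0 ∨ b = 1)
    (c : Fin 4) :
    christoffel g c 2 b x
      = if c = 2 then pd b (fun y => g y 2 2) x / (2 * g x 2 2) else 0 := by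
  have hp := (h.pos x hx).ne'
  rcases hb with rfl | rfl <;>
  · simp only [christoffel, Fin.sum_univ_four, h.inv_apply hx, h.pd_offdiag hx]
    fin_cases c <;> simp [h.u2 x hx, h.u3 x hx, h.e2 x hx, h.e3 x hx, h.dg2 x hx]
    field_simp

theorem christoffel_three (h : IsPolarForm U g u e) (hx : x ∈ U) {b : Fin 4} (hb : b = 0 ∨ b = 1)
    (c : Fin 4) :
    christoffel g c 3 b x
      = if c = 3 then pd b (fun y => g y 2 2) x / (2 * g x 2 2) else 0 := by
  have hp := (h.pos x hx).ne'
  have hs := (h.sin_pos x hx).ne'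
  rcases hb with rfl | rfl <;>
  · simp only [christoffel, Fin.sum_univ_four, h.inv_apply hx, h.pd_offdiag hx, h.dg3 x hx,
      h.pd_g33 hx]
    fin_cases c <;> simp [h.u2 x hx, h.u3 x hx, h.e2 x hx, h.e3 x hx]
    field_simp

theorem contDiffOn_radialGrad (h : IsPolarForm U g u e) (c : Fin 4) :
    ContDiffOn ℝ ∞ (radialGrad g u e c) U :=
  ((h.smooth_u c).mul (contDiffOn_along h.isOpen h.smooth_u (h.smooth_g 2 2))).neg.add
    ((h.smooth_e c).mul (contDiffOn_along h.isOpen h.smooth_e (h.smooth_g 2 2)))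

/-- The two-dimensional divergence, orthogonal to the shells, of a field `v` orthogonal to them. -/
noncomputable def normalDiv (g : TensorField 4) (v : Fin 4 → Coord 4 → ℝ) (x : Coord 4) : ℝ :=
  (pd 0 (v 0) x + pd 1 (v 1) x)
    + (christoffel g 0 0 0 x + christoffel g 1 1 0 x) * v 0 x
    + (christoffel g 0 0 1 x + christoffel g 1 1 1 x) * v 1 x

theorem radialGrad_two (h : IsPolarForm U g u e) (x) (hx : x ∈ U) : radialGrad g u e 2 x = 0 := by
  simp [radialGrad, h.u2 x hx, h.e2 x hx]

theorem radialGrad_three (h : IsPolarForm U g u e) (x) (hx : x ∈ U) :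
    radialGrad g u e 3 x = 0 := by
  simp [radialGrad, h.u3 x hx, h.e3 x hx]

theorem pd_christoffel_cot (h : IsPolarForm U g u e) (hx : x ∈ U) :
    pd 2 (christoffel g 3 3 2) x = -(1 / Real.sin (x 2) ^ 2) := by
  rw [pd_congr h.isOpen hx (h := fun y => (fun t => Real.cos t / Real.sin t) (y 2))
    (fun y hy => by rw [h.christoffel_comm hy, h.christoffel_two_three hy]; rfl),
    pd_comp_coord 2 (hasDerivAt_cot (h.sin_pos x hx).ne')]
  simp

/-- The unit sphere contributes `1`. The terms quadratic in the gradient of `a` cancel between the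
two Christoffel products, leaving a pure divergence. -/
theorem ricci_two_two (h : IsPolarForm U g u e) (hx : x ∈ U) :
    ricci g x 2 2 = 1 - 1 / 2 * normalDiv g (radialGrad g u e) x := by
  have hp := (h.pos x hx).ne'
  have hs := (h.sin_pos x hx).ne'
  have hd : ∀ c, pd c (christoffel g c 2 2) x = -(1 / 2) * pd c (radialGrad g u e c) x := fun c => by
    rw [pd_congr h.isOpen hx (fun y hy => h.christoffel_two_two hy c),
      pd_const_mul _ (differentiableAt_of_contDiffOn h.isOpen hx (h.contDiffOn_radialGrad c))]
  have hz : ∀ c, c ≠ 3 → pd 2 (christoffel g c c 2) x = 0 := fun c hc =>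
    pd_eq_zero h.isOpen hx (c := 0) (fun y hy => by
      rw [h.christoffel_comm hy]
      fin_cases c
      · simp [h.christoffel_two hy]
      · simp [h.christoffel_two hy]
      · simp [h.christoffel_two_two hy, h.radialGrad_two y hy]
      · simp at hc) 2
  simp only [ricci, riemann, Fin.sum_univ_four, hd, hz 0 (by decide), hz 1 (by decide),
    h.pd_christoffel_cot hx, pd_eq_zero h.isOpen hx h.radialGrad_two,
    pd_eq_zero h.isOpen hx h.radialGrad_three]
  simp only [h.christoffel_comm hx _ 0 2, h.christoffel_comm hx _ 1 2, h.christoffel_comm hx _ 3 2,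
    h.christoffel_two_two hx, h.christoffel_two hx (b := 0) (by simp),
    h.christoffel_two hx (b := 1) (by simp), h.christoffel_two_three hx, h.radialGrad_two x hx,
    h.radialGrad_three x hx, h.christoffel_three hx (b := 0) (by simp),
    h.christoffel_three hx (b := 1) (by simp)]
  simp [normalDiv]
  -- The sphere term is `1/sin² θ - cot² θ = 1`.
  have := Real.sin_sq_add_cos_sq (x 2)
  field_simp
  linear_combination (-4 * g x 2 2) * this

theorem ricci_three_three (h : IsPolarForm U g u e) (hx : x ∈ U) :
    ricci g x 3 3
      = Real.sin (x 2) ^ 2 * (1 - 1 / 2 * normalDiv g (radialGrad g u e) x) := by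
  have hp := (h.pos x hx).ne'
  have hs := (h.sin_pos x hx).ne'
  have hd : ∀ c, c = 0 ∨ c = 1 → pd c (christoffel g c 3 3) x
      = Real.sin (x 2) ^ 2 * (-(1 / 2) * pd c (radialGrad g u e c) x) := fun c hc => by
    have h1 := differentiableAt_of_contDiffOn h.isOpen hx (h.contDiffOn_radialGrad c)
    rw [pd_congr h.isOpen hx (h := fun y => Real.sin (y 2) ^ 2 * (-(1 / 2) * radialGrad g u e c y))
      (fun y hy => by rw [h.christoffel_three_three hy]; rcases hc with rfl | rfl <;> simp),
      pd_sin_sq_mul 2 (h1.const_mul _), pd_const_mul _ h1]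
    rcases hc with rfl | rfl <;> simp
  have hd2 : pd 2 (christoffel g 2 3 3) x = Real.sin (x 2) ^ 2 - Real.cos (x 2) ^ 2 := by
    have h1 : HasDerivAt (fun t => -(Real.sin t * Real.cos t))
        (Real.sin (x 2) ^ 2 - Real.cos (x 2) ^ 2) (x 2) := by
      rw [show Real.sin (x 2) ^ 2 - Real.cos (x 2) ^ 2
        = -(Real.cos (x 2) * Real.cos (x 2) + Real.sin (x 2) * -Real.sin (x 2)) by ring]
      exact ((Real.hasDerivAt_sin (x 2)).fun_mul (Real.hasDerivAt_cos (x 2))).fun_neg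
    rw [pd_congr h.isOpen hx (h := fun y => (fun t => -(Real.sin t * Real.cos t)) (y 2))
      (fun y hy => by simp [h.christoffel_three_three hy, h.radialGrad_two y hy]),
      pd_comp_coord 2 h1]
    simp
  have hd3 : pd 3 (christoffel g 3 3 3) x = 0 :=
    pd_eq_zero h.isOpen hx (c := 0)
      (fun y hy => by simp [h.christoffel_three_three hy, h.radialGrad_three y hy]) 3
  have hz : ∀ c, c ≠ 3 → pd 3 (christoffel g c c 3) x = 0 := fun c hc =>
    pd_eq_zero h.isOpen hx (c := 0) (fun y hy => by
      fin_cases c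
      · simp [h.christoffel_comm hy 0 0 3, h.christoffel_three hy]
      · simp [h.christoffel_comm hy 1 1 3, h.christoffel_three hy]
      · simp [h.christoffel_two_three hy]
      · simp at hc) 3
  simp only [ricci, riemann, Fin.sum_univ_four, hd 0 (by simp), hd 1 (by simp), hd2, hd3,
    hz 0 (by decide), hz 1 (by decide), hz 2 (by decide)]
  simp only [h.christoffel_comm hx _ 0 2, h.christoffel_comm hx _ 1 2, h.christoffel_comm hx _ 3 2,
    h.christoffel_comm hx _ 0 3, h.christoffel_comm hx _ 1 3,
    h.christoffel_two_two hx, h.christoffel_two hx (b := 0) (by simp),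
    h.christoffel_two hx (b := 1) (by simp), h.christoffel_two_three hx, h.radialGrad_two x hx,
    h.radialGrad_three x hx, h.christoffel_three hx (b := 0) (by simp),
    h.christoffel_three hx (b := 1) (by simp), h.christoffel_three_three hx]
  simp [normalDiv]
  field_simp
  ring

/-! ### Divergences of the frame -/

/-- The derivative of a constant scalar product vanishes. This trades derivatives of `γ` for
derivatives of the frame. -/
theorem pd_frame_product (h : IsPolarForm U g u e) (hx : x ∈ U) {v w : VecField 4}
    (hv : ∀ a, ContDiffOn ℝ ∞ (fun x => v x a) U) (hw : ∀ a, ContDiffOn ℝ ∞ (fun x => w x a) U)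
    {k : ℝ} (hk : ∀ y ∈ U, g y 0 0 * v y 0 * w y 0 + g y 0 1 * (v y 0 * w y 1 + v y 1 * w y 0)
      + g y 1 1 * v y 1 * w y 1 = k) (c : Fin 4) :
    pd c (fun y => g y 0 0) x * v x 0 * w x 0
      + pd c (fun y => g y 0 1) x * (v x 0 * w x 1 + v x 1 * w x 0)
      + pd c (fun y => g y 1 1) x * v x 1 * w x 1
      + (g x 0 0 * w x 0 + g x 0 1 * w x 1) * pd c (fun y => v y 0) x
      + (g x 0 1 * w x 0 + g x 1 1 * w x 1) * pd c (fun y => v y 1) x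
      + (g x 0 0 * v x 0 + g x 0 1 * v x 1) * pd c (fun y => w y 0) x
      + (g x 0 1 * v x 0 + g x 1 1 * v x 1) * pd c (fun y => w y 1) x = 0 := by
  have dg := h.differentiableAt_g hx
  have dv := fun a => differentiableAt_of_contDiffOn h.isOpen hx (hv a)
  have dw := fun a => differentiableAt_of_contDiffOn h.isOpen hx (hw a)
  have h1 := pd_eq_zero h.isOpen hx hk c
  rw [pd_add ((((dg 0 0).fun_mul (dv 0)).fun_mul (dw 0)).fun_add ((dg 0 1).fun_mul
      (((dv 0).fun_mul (dw 1)).fun_add ((dv 1).fun_mul (dw 0)))))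
      (((dg 1 1).fun_mul (dv 1)).fun_mul (dw 1)),
    pd_add (((dg 0 0).fun_mul (dv 0)).fun_mul (dw 0)) ((dg 0 1).fun_mul
      (((dv 0).fun_mul (dw 1)).fun_add ((dv 1).fun_mul (dw 0)))),
    pd_mul ((dg 0 0).fun_mul (dv 0)) (dw 0), pd_mul (dg 0 0) (dv 0),
    pd_mul (dg 0 1) (((dv 0).fun_mul (dw 1)).fun_add ((dv 1).fun_mul (dw 0))),
    pd_add ((dv 0).fun_mul (dw 1)) ((dv 1).fun_mul (dw 0)), pd_mul (dv 0) (dw 1),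
    pd_mul (dv 1) (dw 0), pd_mul ((dg 1 1).fun_mul (dv 1)) (dw 1), pd_mul (dg 1 1) (dv 1)] at h1
  linear_combination h1

/-- The completeness relation `-uᵃ u_b + eᵃ e_b = δᵃ_b` orthogonally to the shells. -/
theorem completeness (h : IsPolarForm U g u e) (hx : x ∈ U) {a : Fin 4} (ha : a = 0 ∨ a = 1)
    (b : Fin 4) :
    (-(u x a * u x 0) + e x a * e x 0) * g x 0 b + (-(u x a * u x 1) + e x a * e x 1) * g x 1 b
      = if a = b then 1 else 0 := by
  have := congrFun (congrFun (Matrix.nonsing_inv_mul (g x) (h.isUnit_det hx)) a) b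
  rw [Matrix.mul_apply, Matrix.one_apply] at this
  rw [← this]
  rcases ha with rfl | rfl <;>
    simp [h.inv_apply hx, Fin.sum_univ_four, h.u2 x hx, h.u3 x hx, h.e2 x hx, h.e3 x hx]

/-- By completeness the divergence is `(-uᵃuᵇ + eᵃeᵇ) ∇_a u_b`, and `uᵇ ∇_a u_b = 0` because `u` has
constant norm. -/
theorem normalDiv_u (h : IsPolarForm U g u e) (hx : x ∈ U) :
    normalDiv g (fun a y => u y a) x = longitudinalExpansion g u e x := by
  have hU := fun c => h.pd_frame_product hx h.smooth_u h.smooth_u (k := -1)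
    (fun y hy => by linear_combination h.unit_u y hy) c
  have c0 := h.completeness hx (a := 0) (by simp)
  have c1 := h.completeness hx (a := 1) (by simp)
  have c00 := c0 0
  have c01 := c0 1
  have c10 := c1 0
  have c11 := c1 1
  have s := h.symm x hx 0 1
  have s' := h.pd_symm hx 0 1
  simp only [s] at c00 c10
  simp at c00 c01 c10 c11
  simp only [normalDiv, longitudinalExpansion, christoffel, h.inv_apply hx,
    h.covDeriv_lower hx h.smooth_u, Fin.sum_univ_four, h.u2 x hx, h.u3 x hx, h.e2 x hx, h.e3 x hx,
    h.pd_offdiag hx, h.g02 x hx, h.g12 x hx, h.g03 x hx, h.g13 x hx, h.g20 x hx, h.g21 x hx,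
    h.g30 x hx, h.g31 x hx, s, s']
  simp
  linear_combination -pd 0 (fun y => u y 0) x * c00 - pd 0 (fun y => u y 1) x * c01
    - pd 1 (fun y => u y 0) x * c10 - pd 1 (fun y => u y 1) x * c11
    - 1 / 2 * u x 0 * hU 0 - 1 / 2 * u x 1 * hU 1

/-- Constant norm of `e` leaves `-uᵃuᵇ ∇_a e_b`, which is `uᵃeᵇ ∇_a u_b` since `u` and `e` stay
orthogonal. -/
theorem normalDiv_e (h : IsPolarForm U g u e) (hx : x ∈ U) :
    normalDiv g (fun a y => e y a) x = acceleration g u e x := by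
  have hE := fun c => h.pd_frame_product hx h.smooth_e h.smooth_e (k := 1)
    (fun y hy => by linear_combination h.unit_e y hy) c
  have hUE := fun c => h.pd_frame_product hx h.smooth_u h.smooth_e h.orthogonal c
  have c0 := h.completeness hx (a := 0) (by simp)
  have c1 := h.completeness hx (a := 1) (by simp)
  have c00 := c0 0
  have c01 := c0 1
  have c10 := c1 0
  have c11 := c1 1
  have s := h.symm x hx 0 1
  have s' := h.pd_symm hx 0 1
  simp only [s] at c00 c10
  simp at c00 c01 c10 c11
  simp only [normalDiv, acceleration, christoffel, h.inv_apply hx,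
    h.covDeriv_lower hx h.smooth_u, Fin.sum_univ_four, h.u2 x hx, h.u3 x hx, h.e2 x hx, h.e3 x hx,
    h.pd_offdiag hx, h.g02 x hx, h.g12 x hx, h.g03 x hx, h.g13 x hx, h.g20 x hx, h.g21 x hx,
    h.g30 x hx, h.g31 x hx, s, s']
  simp
  linear_combination -pd 0 (fun y => e y 0) x * c00 - pd 0 (fun y => e y 1) x * c01
    - pd 1 (fun y => e y 0) x * c10 - pd 1 (fun y => e y 1) x * c11
    + 1 / 2 * e x 0 * hE 0 + 1 / 2 * e x 1 * hE 1 - u x 0 * hUE 0 - u x 1 * hUE 1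

theorem normalDiv_radialGrad (h : IsPolarForm U g u e) (hx : x ∈ U) :
    normalDiv g (radialGrad g u e) x
      = -along u (along u fun y => g y 2 2) x + along e (along e fun y => g y 2 2) x
        - longitudinalExpansion g u e x * along u (fun y => g y 2 2) x
        + acceleration g u e x * along e (fun y => g y 2 2) x := by
  have du := fun a => differentiableAt_of_contDiffOn h.isOpen hx (h.smooth_u a)
  have de := fun a => differentiableAt_of_contDiffOn h.isOpen hx (h.smooth_e a)
  have dU := differentiableAt_of_contDiffOn h.isOpen hx
    (contDiffOn_along h.isOpen h.smooth_u (h.smooth_g 2 2))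
  have dE := differentiableAt_of_contDiffOn h.isOpen hx
    (contDiffOn_along h.isOpen h.smooth_e (h.smooth_g 2 2))
  have key : ∀ c, pd c (radialGrad g u e c) x
      = -(u x c * pd c (along u fun y => g y 2 2) x
          + pd c (fun y => u y c) x * along u (fun y => g y 2 2) x)
        + (e x c * pd c (along e fun y => g y 2 2) x
          + pd c (fun y => e y c) x * along e (fun y => g y 2 2) x) := fun c => by
    unfold radialGrad
    rw [pd_add ((du c).fun_mul dU).fun_neg ((de c).fun_mul dE), pd_neg, pd_mul (du c) dU,
      pd_mul (de c) dE]
  have e1 : along u (along u fun y => g y 2 2) x = u x 0 * pd 0 (along u fun y => g y 2 2) x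
      + u x 1 * pd 1 (along u fun y => g y 2 2) x := by
    rw [along]; simp [Fin.sum_univ_four, h.u2 x hx, h.u3 x hx]
  have e2 : along e (along e fun y => g y 2 2) x = e x 0 * pd 0 (along e fun y => g y 2 2) x
      + e x 1 * pd 1 (along e fun y => g y 2 2) x := by
    rw [along]; simp [Fin.sum_univ_four, h.e2 x hx, h.e3 x hx]
  rw [← h.normalDiv_u hx, ← h.normalDiv_e hx, e1, e2]
  simp only [normalDiv, key]
  simp only [radialGrad]
  ring

/-! ### Matter -/

/-- Since `p + Π = T_ab eᵃeᵇ`, the left side is `R_uu - R_ee + R`. The trace `R` cancels the first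
two terms and leaves the angular Ricci components. -/
theorem energyDensity_sub (h : IsPolarForm U g u e) (hx : x ∈ U) {T : TensorField 4}
    (hT : EinsteinEquations U g T) :
    energyDensity T u x - pressure g T u x - anisotropicPressure g T u e x
      = (2 - normalDiv g (radialGrad g u e) x) / g x 2 2 := by
  have hp := (h.pos x hx).ne'
  have hs := (h.sin_pos x hx).ne'
  have hPi : anisotropicPressure g T u e x
      = (∑ a, ∑ b, T x a b * e x a * e x b) - pressure g T u x := by
    have h1 := h.sum_hLow_mul_e hx
    have h2 := h.sum_projected_mul_e hx fun c d => (T x c d + T x d c) / 2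
    have h3 : ∑ a, ∑ b, anisotropicStress g T u x a b * e x a * e x b
        = (∑ a, ∑ b, (∑ c, ∑ d, hMix g u x c a * hMix g u x d b * ((T x c d + T x d c) / 2))
            * e x a * e x b)
          - pressure g T u x * ∑ a, ∑ b, hLow g u x a b * e x a * e x b := by
      simp only [anisotropicStress, Finset.mul_sum, ← Finset.sum_sub_distrib]
      exact Finset.sum_congr rfl fun a _ => Finset.sum_congr rfl fun b _ => by ring
    rw [anisotropicPressure, h3, h2, h1]
    simp only [Fin.sum_univ_four]
    ring
  have hR : scalarCurvature g x = -(∑ a, ∑ b, ricci g x a b * u x a * u x b)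
      + ((∑ a, ∑ b, ricci g x a b * e x a * e x b)
      + (ricci g x 2 2 + ricci g x 3 3 / Real.sin (x 2) ^ 2) / g x 2 2) := by
    rw [← h.sum_hUp_mul hx]
    simp only [scalarCurvature, hUp, ← Finset.sum_neg_distrib, ← Finset.sum_add_distrib]
    exact Finset.sum_congr rfl fun a _ => Finset.sum_congr rfl fun b _ => by ring
  have hT' (v : Fin 4 → ℝ) : ∑ a, ∑ b, T x a b * v a * v b
      = (∑ a, ∑ b, ricci g x a b * v a * v b)
        - 1 / 2 * scalarCurvature g x * ∑ a, ∑ b, g x a b * v a * v b := by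
    simp only [← hT x hx, einstein, Finset.mul_sum, ← Finset.sum_sub_distrib]
    exact Finset.sum_congr rfl fun a _ => Finset.sum_congr rfl fun b _ => by ring
  have hu : ∑ a, ∑ b, g x a b * u x a * u x b = -1 := by
    simp only [Fin.sum_univ_four, h.u2 x hx, h.u3 x hx]
    linear_combination h.unit_u x hx + u x 0 * u x 1 * h.symm x hx 0 1
  have he : ∑ a, ∑ b, g x a b * e x a * e x b = 1 := by
    simp only [Fin.sum_univ_four, h.e2 x hx, h.e3 x hx]
    linear_combination h.unit_e x hx + e x 0 * e x 1 * h.symm x hx 0 1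
  have h33 : ricci g x 2 2 + ricci g x 3 3 / Real.sin (x 2) ^ 2
      = 2 - normalDiv g (radialGrad g u e) x := by
    rw [h.ricci_two_two hx, h.ricci_three_three hx]
    field_simp
    ring
  rw [hPi, energyDensity, hT' (u x), hT' (e x), hu, he, ← h33]
  linear_combination hR

/-! ### Smoothness, propagation of `K`, the mass and the restoration factor. -/

theorem contDiffOn_gaussCurvature (h : IsPolarForm U g u e) :
    ContDiffOn ℝ ∞ (gaussCurvature g) U :=
  (contDiffOn_const.div (h.smooth_g 2 2) fun y hy => (h.pos y hy).ne').congr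
    fun _ hy => h.gaussCurvature_eq hy

theorem contDiffOn_Psi (h : IsPolarForm U g u e) : ContDiffOn ℝ ∞ (Psi g u e) U :=
  ((contDiffOn_along h.isOpen h.smooth_u (h.smooth_g 2 2)).div (h.smooth_g 2 2)
    fun y hy => (h.pos y hy).ne').neg.congr fun _ hy => h.Psi_eq hy

theorem contDiffOn_sheetExpansion (h : IsPolarForm U g u e) :
    ContDiffOn ℝ ∞ (sheetExpansion g u e) U :=
  ((contDiffOn_along h.isOpen h.smooth_e (h.smooth_g 2 2)).div (h.smooth_g 2 2)
    fun y hy => (h.pos y hy).ne').congr fun _ hy => h.sheetExpansion_eq hy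

theorem along_gaussCurvature (h : IsPolarForm U g u e) (hx : x ∈ U) (v : VecField 4) :
    along v (gaussCurvature g) x
      = -(along v (fun y => g y 2 2) x / g x 2 2) * gaussCurvature g x := by
  have hp := (h.pos x hx).ne'
  rw [along_congr h.isOpen hx (h := fun y => (fun t => t⁻¹) (g y 2 2))
    (fun y hy => by rw [h.gaussCurvature_eq hy, one_div]),
    along_comp (hasDerivAt_inv hp) (h.differentiableAt_g hx 2 2), h.gaussCurvature_eq hx]
  field_simp

theorem along_u_gaussCurvature (h : IsPolarForm U g u e) (hx : x ∈ U) :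
    along u (gaussCurvature g) x = Psi g u e x * gaussCurvature g x := by
  rw [h.along_gaussCurvature hx, h.Psi_eq hx]

theorem along_e_gaussCurvature (h : IsPolarForm U g u e) (hx : x ∈ U) :
    along e (gaussCurvature g) x = -sheetExpansion g u e x * gaussCurvature g x := by
  rw [h.along_gaussCurvature hx, h.sheetExpansion_eq hx]

/-- Differentiating the first-order equations once more gives `K̈ = (Ψ̇ + Ψ²) K` and `-φ̂ + φ²` as
the factor of `K` in the second hat derivative. -/
theorem wave_gaussCurvature (h : IsPolarForm U g u e) (hx : x ∈ U) :
    along u (along u (gaussCurvature g)) x - along e (along e (gaussCurvature g)) x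
      + restorationFactor g u e x * gaussCurvature g x = 0 := by
  have dK := differentiableAt_of_contDiffOn h.isOpen hx h.contDiffOn_gaussCurvature
  have dP := differentiableAt_of_contDiffOn h.isOpen hx h.contDiffOn_Psi
  have dS := differentiableAt_of_contDiffOn h.isOpen hx h.contDiffOn_sheetExpansion
  rw [along_congr h.isOpen hx (fun y hy => h.along_u_gaussCurvature hy), along_mul dP dK,
    along_congr h.isOpen hx (fun y hy => h.along_e_gaussCurvature hy), along_mul dS.fun_neg dK,
    h.along_u_gaussCurvature hx, h.along_e_gaussCurvature hx, restorationFactor]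
  have : along e (fun y => -sheetExpansion g u e y) x = -along e (sheetExpansion g u e) x := by
    simp [along, pd_neg]
  rw [this]
  ring

/-- Here `C = √a`, so `∇C = ∇a / (2√a)`. Its squared norm is `(φ² - Ψ²) a / 4`, the minus sign
coming from the timelike `u`. -/
theorem misnerSharpMass_mul (h : IsPolarForm U g u e) (hx : x ∈ U) :
    16 * misnerSharpMass g x * gaussCurvature g x ^ (3 / 2 : ℝ)
      = 8 * gaussCurvature g x - 2 * (sheetExpansion g u e x ^ 2 - Psi g u e x ^ 2) := by
  have hp := h.pos x hx
  have hsq : 0 < √(g x 2 2) := Real.sqrt_pos.mpr hp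
  have hC : ∀ y ∈ U, areaRadius g y = √(g y 2 2) := fun y hy => by
    rw [areaRadius, h.gaussCurvature_eq hy, one_div, one_div, Real.sqrt_inv, inv_inv]
  have hpd : ∀ a, pd a (areaRadius g) x = 1 / (2 * √(g x 2 2)) * pd a (fun y => g y 2 2) x :=
    fun a => by
      rw [pd_congr h.isOpen hx hC, pd_comp (Real.hasDerivAt_sqrt hp.ne')
        (h.differentiableAt_g hx 2 2)]
  have hgrad : ∑ a, ∑ b, (g x)⁻¹ a b * pd a (areaRadius g) x * pd b (areaRadius g) x
      = (1 / (2 * √(g x 2 2))) ^ 2 * (along e (fun y => g y 2 2) x ^ 2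
        - along u (fun y => g y 2 2) x ^ 2) := by
    simp [hpd, h.inv_apply hx, along, Fin.sum_univ_four, h.u2 x hx, h.u3 x hx, h.e2 x hx,
      h.e3 x hx, h.dg2 x hx, h.dg3 x hx]
    ring
  have hpow : gaussCurvature g x ^ (3 / 2 : ℝ) = 1 / (g x 2 2 * √(g x 2 2)) := by
    rw [h.gaussCurvature_eq hx, show (3 / 2 : ℝ) = 1 + 1 / 2 by norm_num,
      Real.rpow_add (by positivity), Real.rpow_one, ← Real.sqrt_eq_rpow, one_div, Real.sqrt_inv]
    field_simp
  have hss : √(g x 2 2) ^ 2 = g x 2 2 := Real.sq_sqrt hp.le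
  rw [misnerSharpMass, hgrad, hC x hx, hpow, h.gaussCurvature_eq hx, h.Psi_eq hx,
    h.sheetExpansion_eq hx, div_pow, mul_pow, hss]
  field_simp
  ring

theorem restorationFactor_eq (h : IsPolarForm U g u e) (hx : x ∈ U) {T : TensorField 4}
    (hT : EinsteinEquations U g T) :
    restorationFactor g u e x
      = 6 * gaussCurvature g x
        - 16 * misnerSharpMass g x * gaussCurvature g x ^ (3 / 2 : ℝ)
        + Psi g u e x ^ 2 + Psi g u e x * expansion g u x
        + acceleration g u e x * sheetExpansion g u e x
        + energyDensity T u x - pressure g T u x - anisotropicPressure g T u e x := by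
  have hp := (h.pos x hx).ne'
  have dg := h.differentiableAt_g hx 2 2
  have dP := differentiableAt_of_contDiffOn h.isOpen hx h.contDiffOn_Psi
  have dS := differentiableAt_of_contDiffOn h.isOpen hx h.contDiffOn_sheetExpansion
  have hU : ∀ y ∈ U, along u (fun z => g z 2 2) y = -Psi g u e y * g y 2 2 := fun y hy => by
    have := (h.pos y hy).ne'
    rw [h.Psi_eq hy]; field_simp
  have hE : ∀ y ∈ U, along e (fun z => g z 2 2) y = sheetExpansion g u e y * g y 2 2 :=
    fun y hy => by
      have := (h.pos y hy).ne'
      rw [h.sheetExpansion_eq hy]; field_simp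
  have hUU : along u (along u fun z => g z 2 2) x
      = (Psi g u e x ^ 2 - along u (Psi g u e) x) * g x 2 2 := by
    rw [along_congr h.isOpen hx hU, along_mul dP.fun_neg dg, hU x hx]
    have : along u (fun y => -Psi g u e y) x = -along u (Psi g u e) x := by
      simp [along, pd_neg]
    rw [this]; ring
  have hEE : along e (along e fun z => g z 2 2) x
      = (sheetExpansion g u e x ^ 2 + along e (sheetExpansion g u e) x) * g x 2 2 := by
    rw [along_congr h.isOpen hx hE, along_mul dS dg, hE x hx]; ring
  have hTh : longitudinalExpansion g u e x = expansion g u x + Psi g u e x := by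
    rw [h.expansion_eq hx, h.Psi_eq hx]; ring
  have hM := h.energyDensity_sub hx hT
  rw [h.normalDiv_radialGrad hx, hUU, hEE, hU x hx, hE x hx, hTh] at hM
  -- The angular Einstein equation divided by `a`: the second derivatives of `a` have become `Ψ̇`
  -- and `φ̂`, which occur here in the same sum as in the restoration factor.
  have hM' : energyDensity T u x - pressure g T u x - anisotropicPressure g T u e x
      = 2 * gaussCurvature g x - (along u (Psi g u e) x - Psi g u e x ^ 2
        + sheetExpansion g u e x ^ 2 + along e (sheetExpansion g u e) x
        + (expansion g u x + Psi g u e x) * Psi g u e x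
        + acceleration g u e x * sheetExpansion g u e x) := by
    rw [hM, h.gaussCurvature_eq hx]
    field_simp
    ring
  rw [restorationFactor]
  linear_combination h.misnerSharpMass_mul hx - hM'

end IsPolarForm

end SphericalSpacetime

theorem mainTheorem1 (U : Set (Coord 4)) (g T : TensorField 4) (u e : VecField 4)
    (hS : IsSphericallySymmetric U g u e) (hT : EinsteinEquations U g T) :
    ContDiffOn ℝ ∞ (gaussCurvature g) U ∧
    ContDiffOn ℝ ∞ (Psi g u e) U ∧
    ContDiffOn ℝ ∞ (sheetExpansion g u e) U ∧
    ∀ x ∈ U,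
      0 < gaussCurvature g x ∧
      along u (gaussCurvature g) x
        = (shear g u e x - 2 / 3 * expansion g u x) * gaussCurvature g x ∧
      along e (gaussCurvature g) x = -sheetExpansion g u e x * gaussCurvature g x ∧
      along u (along u (gaussCurvature g)) x - along e (along e (gaussCurvature g)) x
        + restorationFactor g u e x * gaussCurvature g x = 0 ∧
      restorationFactor g u e x
        = 6 * gaussCurvature g x
          - 16 * misnerSharpMass g x * gaussCurvature g x ^ (3 / 2 : ℝ)
          + Psi g u e x ^ 2 + Psi g u e x * expansion g u x
          + acceleration g u e x * sheetExpansion g u e x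
          + energyDensity T u x - pressure g T u x - anisotropicPressure g T u e x := by
  have h := hS.isPolarForm
  refine ⟨h.contDiffOn_gaussCurvature, h.contDiffOn_Psi, h.contDiffOn_sheetExpansion,
    fun x hx => ⟨?_, h.along_u_gaussCurvature hx, h.along_e_gaussCurvature hx,
      h.wave_gaussCurvature hx, h.restorationFactor_eq hx hT⟩⟩
  rw [h.gaussCurvature_eq hx]
  exact one_div_pos.mpr (h.pos x hx)
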